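/- **Setting.** A cell-free system has $M$ access points (APs) with $N$ antennas each and $K$ single-antenna UEs. The UEs are split into disjoint sets $\mathcal U_u$ (uplink) and $\mathcal U_d$ (downlink) whose union is all UEs, and $\mathcal A_d$ is the set of downlink APs. The channel from UE $k$ to AP $m$ is $\mathbf f_{mk}=\sqrt{\beta_{mk}}\,\mathbf h_{mk}\in\mathbb C^N$ with $\beta_{mk}>0$ and $\mathbf h_{mk}\sim\mathcal{CN}(\mathbf 0,\mathbf I_N)$. Let $\boldsymbol\varphi_1,\dots,\boldsymbol\varphi_{\tau_p}\in\mathbb C^{\tau_p}$ be orthonormal pilots, let UE $k$ use $\boldsymbol\varphi_{l(k)}$ with pilot power $\mathcal E_{p,k}\ge 0$, and let $\mathcal P_{l(k)}$ be the set of UEs, including $k$, that use the pilot of UE $k$. AP $m$ receives $$\mathbf Y_{p,m}=\sum_{k}\sqrt{\tau_p\mathcal E_{p,k}}\,\mathbf f_{mk}\boldsymbol\varphi_{l(k)}^T+\mathbf W_{p,m}\in\mathbb C^{N\times\tau_p},$$ where $\mathbf W_{p,m}$ has i.i.d. $\mathcal{CN}(0,N_0)$ entries, $N_0>0$; all $\mathbf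 h_{mk}$ and $\mathbf W_{p,m}$ are mutually independent. The channel from uplink UE $k$ to downlink UE $n$ is $\mathtt g_{nk}\sim\mathcal{CN}(0,\epsilon_{nk})$. Put $$c_{mk}=\Big(\tau_p\mathcal E_{p,k}\beta_{mk}+\tau_p\sum_{i\in\mathcal P_{l(k)}\setminus k}\mathcal E_{p,i}\beta_{mi}+N_0\Big)^{-1},\qquad \alpha_{mk}=\sqrt{c_{mk}\tau_p\mathcal E_{p,k}\beta_{mk}^2}.$$ Assume $N\ge\tau_p+1$. Let $\mathbf Z_j=\mathbf Y_{p,j}\boldsymbol\Phi^*$, where $\boldsymbol\Phi$ has columns $\boldsymbol\varphi_l$ and $^*$ is the entrywise conjugate, and let $$\mathbf p_{jn}=\frac{\mathbf Z_j(\mathbf Z_j^H\mathbf Z_j)^{-1}\mathbf e_{l(n)}}{\sqrt{\mathbb E\|\mathbf Z_j(\mathbf Z_j^H\mathbf Z_j)^{-1}\mathbf e_{l(n)}\|^2}}$$ be the unit-normalized zero-forcing (ZF) precoder of AP $j$ for UE $n$. With downlink power $\mathcal E_d\ge0$, uplink powers $\mathcal E_{u,k}\ge 0$ and real power control coefficients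 $\kappa_{jn}$, put $D_{nq}=\sum_{j\in\mathcal A_d}\kappa_{jq}\mathbf f_{jn}^H\mathbf p_{jq}$. The DL SINR of UE $n\in\mathcal U_d$ is $$\eta_{d,n}=\frac{\mathcal E_d|\mathbb E D_{nn}|^2}{\mathcal E_d\operatorname{var}\{D_{nn}\}+\mathcal E_d\sum_{q\in\mathcal U_d\setminus n}\mathbb E|D_{nq}|^2+\sum_{k\in\mathcal U_u}\mathcal E_{u,k}\mathbb E|\mathtt g_{nk}|^2+N_0}.$$ **Lemma.** For $j\in\mathcal A_d$, $q\in\mathcal U_d$ and $k\in\mathcal U_u$, the quantities $\mathbb E\|\mathbf Z_j(\mathbf Z_j^H\mathbf Z_j)^{-1}\mathbf e_{l(q)}\|^2$, $\mathbb E|\mathbf f_{jn}^H\mathbf p_{jq}|^2$ and $\mathbb E|\mathtt g_{nk}|^2$ are finite, the first one is positive, and $$\eta_{d,n}=\frac{(N-\tau_p)\,\mathcal E_d\big(\sum_{j\in\mathcal A_d}\alpha_{jn}\kappa_{jn}\big)^2}{\mathtt{EST}_{d,n}+\mathtt{MUI}_{d,n}+\mathtt{IUE}_n+N_0},$$ where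 $$\mathtt{EST}_{d,n}=\sum_{q\in\mathcal U_d}\sum_{j\in\mathcal A_d}\mathcal E_d\kappa_{jq}^2(\beta_{jn}-\alpha_{jn}^2),$$ $$\mathtt{MUI}_{d,n}=(N-\tau_p)\mathcal E_d\sum_{q\in(\mathcal P_{l(n)}\cap\mathcal U_d)\setminus n}\Big(\sum_{j\in\mathcal A_d}\kappa_{jq}\alpha_{jn}\Big)^2,\qquad \mathtt{IUE}_n=\sum_{k\in\mathcal U_u}\mathcal E_{u,k}\epsilon_{nk}.$$ -/

import Mathlib

open MeasureTheory ProbabilityTheory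
open scoped Matrix BigOperators

noncomputable section

/-- The circularly symmetric complex Gaussian law `CN(0, v)`: real and imaginary parts are
independent real Gaussians of mean `0` and variance `v / 2`. It is meant for `0 ≤ v`. -/
def complexNormal (v : ℝ) : Measure ℂ :=
  ((gaussianReal 0 (v / 2).toNNReal).prod (gaussianReal 0 (v / 2).toNNReal)).map
    (fun p : ℝ × ℝ => (⟨p.1, p.2⟩ : ℂ))

/-- The variance `E|X - E X|²` of a complex random variable. -/
def complexVar {Ω : Type*} [MeasurableSpace Ω] (X : Ω → ℂ) (μ : Measure Ω) : ℝ :=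
  ∫ ω, ‖X ω - ∫ ω', X ω' ∂μ‖ ^ 2 ∂μ

/-- Deterministic data of a cell-free system with `M` access points (APs) of `N` antennas each,
`K` single-antenna user equipments (UEs) and pilots of length `τ`. -/
structure CellFree (M K N τ : ℕ) where
  /-- uplink UEs -/
  Uu : Finset (Fin K)
  /-- downlink UEs -/
  Ud : Finset (Fin K)
  disjoint_UE : Disjoint Uu Ud
  union_UE : Uu ∪ Ud = Finset.univ
  /-- APs scheduled in the downlink -/
  Ad : Finset (Fin M)
  /-- large scale fading coefficients -/
  β : Fin M → Fin K → ℝ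
  β_pos : ∀ m k, 0 < β m k
  /-- noise variance -/
  N0 : ℝ
  N0_pos : 0 < N0
  /-- pilot sequences -/
  φ : Fin τ → EuclideanSpace ℂ (Fin τ)
  φ_orthonormal : Orthonormal ℂ φ
  /-- index of the pilot sequence used by each UE -/
  l : Fin K → Fin τ
  /-- pilot powers -/
  Ep : Fin K → ℝ
  Ep_nonneg : ∀ k, 0 ≤ Ep k
  /-- total radiated power of a downlink AP -/
  Ed : ℝ
  Ed_nonneg : 0 ≤ Ed
  /-- uplink data powers (used only for uplink UEs) -/
  Eu : Fin K → ℝ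
  Eu_nonneg : ∀ k, 0 ≤ Eu k
  /-- downlink power control coefficients `κ j n` of AP `j` for UE `n` (used only for
  downlink APs and downlink UEs) -/
  κ : Fin M → Fin K → ℝ
  /-- variances `ε n k` of the channel from uplink UE `k` to downlink UE `n` -/
  ε : Fin K → Fin K → ℝ
  ε_nonneg : ∀ n k, 0 ≤ ε n k

namespace CellFree

variable {M K N τ : ℕ} (S : CellFree M K N τ)

/-- UEs which use the same pilot as UE `k`, including `k`. -/
def pilotSet (k : Fin K) : Finset (Fin K) :=
  Finset.univ.filter fun i => S.l i = S.l k

/-- `c m k = (τ Ep_k β_mk + τ ∑_{i ∈ P_{l(k)} \ k} Ep_i β_mi + N0)⁻¹`. -/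
def c (m : Fin M) (k : Fin K) : ℝ :=
  ((τ : ℝ) * S.Ep k * S.β m k
    + (τ : ℝ) * ∑ i ∈ (S.pilotSet k).erase k, S.Ep i * S.β m i + S.N0)⁻¹

/-- `α m k`, the standard deviation of each entry of the MMSE channel estimate. -/
def α (m : Fin M) (k : Fin K) : ℝ :=
  Real.sqrt (S.c m k * τ * S.Ep k * S.β m k ^ 2)

/-- The channel `f m k = √β_mk h_mk ∈ ℂᴺ` between AP `m` and UE `k`. -/
def chan {Ω : Type*} (h : Fin M → Fin K → Fin N → Ω → ℂ) (m : Fin M) (k : Fin K) (ω : Ω) :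
    Fin N → ℂ :=
  fun i => (Real.sqrt (S.β m k) : ℂ) * h m k i ω

/-- The received pilot matrix `Y_m = ∑_k √(τ Ep_k) f_mk φ_{l(k)}ᵀ + W_m ∈ ℂ^{N × τ}`. -/
def pilotRx {Ω : Type*} (h : Fin M → Fin K → Fin N → Ω → ℂ)
    (W : Fin M → Fin N → Fin τ → Ω → ℂ) (m : Fin M) (ω : Ω) : Matrix (Fin N) (Fin τ) ℂ :=
  (∑ k, (Real.sqrt (τ * S.Ep k) : ℂ) • Matrix.vecMulVec (S.chan h m k ω) (fun t => S.φ (S.l k) t))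
    + Matrix.of fun i t => W m i t ω

/-- `Z_m = Y_m Φ*`: column `l` of `Z_m` is `Y_m` correlated with the pilot `φ_l`. -/
def Z {Ω : Type*} (h : Fin M → Fin K → Fin N → Ω → ℂ)
    (W : Fin M → Fin N → Fin τ → Ω → ℂ) (m : Fin M) (ω : Ω) : Matrix (Fin N) (Fin τ) ℂ :=
  S.pilotRx h W m ω * Matrix.of fun t l => star (S.φ l t)

/-- The zero-forcing vector before normalization, `Z_j (Z_jᴴ Z_j)⁻¹ e_{l(n)}`. -/
def zfDir {Ω : Type*} (h : Fin M → Fin K → Fin N → Ω → ℂ)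
    (W : Fin M → Fin N → Fin τ → Ω → ℂ) (j : Fin M) (n : Fin K) (ω : Ω) : Fin N → ℂ :=
  (S.Z h W j ω * ((S.Z h W j ω)ᴴ * S.Z h W j ω)⁻¹) *ᵥ Pi.single (S.l n) 1

/-- The squared Euclidean norm of the zero-forcing vector before normalization. -/
def zfNormSq {Ω : Type*} (h : Fin M → Fin K → Fin N → Ω → ℂ)
    (W : Fin M → Fin N → Fin τ → Ω → ℂ) (j : Fin M) (n : Fin K) (ω : Ω) : ℝ :=
  ‖WithLp.toLp 2 (S.zfDir h W j n ω)‖ ^ 2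

/-- The unit-normalized zero-forcing precoder
`p_jn = Z_j (Z_jᴴ Z_j)⁻¹ e_{l(n)} / √(E ‖Z_j (Z_jᴴ Z_j)⁻¹ e_{l(n)}‖²)`. -/
def precoder {Ω : Type*} [MeasurableSpace Ω] (μ : Measure Ω)
    (h : Fin M → Fin K → Fin N → Ω → ℂ) (W : Fin M → Fin N → Fin τ → Ω → ℂ)
    (j : Fin M) (n : Fin K) (ω : Ω) : Fin N → ℂ :=
  ((Real.sqrt (∫ ω', S.zfNormSq h W j n ω' ∂μ) : ℂ))⁻¹ • S.zfDir h W j n ω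

/-- The effective scalar gain `[d_nq]_j = f_jnᴴ p_jq`. -/
def gain {Ω : Type*} [MeasurableSpace Ω] (μ : Measure Ω)
    (h : Fin M → Fin K → Fin N → Ω → ℂ) (W : Fin M → Fin N → Fin τ → Ω → ℂ)
    (n q : Fin K) (j : Fin M) (ω : Ω) : ℂ :=
  star (S.chan h j n ω) ⬝ᵥ S.precoder μ h W j q ω

/-- `κ_qᵀ d_nq = ∑_{j ∈ A_d} κ_jq [d_nq]_j`. -/
def weightedGain {Ω : Type*} [MeasurableSpace Ω] (μ : Measure Ω)
    (h : Fin M → Fin K → Fin N → Ω → ℂ) (W : Fin M → Fin N → Fin τ → Ω → ℂ)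
    (n q : Fin K) (ω : Ω) : ℂ :=
  ∑ j ∈ S.Ad, (S.κ j q : ℂ) * S.gain μ h W n q j ω

/-- The downlink SINR of UE `n`. -/
def dlSINR {Ω : Type*} [MeasurableSpace Ω] (μ : Measure Ω)
    (h : Fin M → Fin K → Fin N → Ω → ℂ) (W : Fin M → Fin N → Fin τ → Ω → ℂ)
    (g : Fin K → Fin K → Ω → ℂ) (n : Fin K) : ℝ :=
  S.Ed * ‖∫ ω, S.weightedGain μ h W n n ω ∂μ‖ ^ 2 /
    (S.Ed * complexVar (S.weightedGain μ h W n n) μ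
      + S.Ed * ∑ q ∈ S.Ud.erase n, ∫ ω, ‖S.weightedGain μ h W n q ω‖ ^ 2 ∂μ
      + ∑ k ∈ S.Uu, S.Eu k * ∫ ω, ‖g n k ω‖ ^ 2 ∂μ
      + S.N0)

/-- Interference due to channel estimation error. -/
def EST (n : Fin K) : ℝ :=
  ∑ q ∈ S.Ud, ∑ j ∈ S.Ad, S.Ed * S.κ j q ^ 2 * (S.β j n - S.α j n ^ 2)

/-- Multi-UE interference from the downlink UEs that share the pilot of UE `n`. -/
def MUI (n : Fin K) : ℝ :=
  ((N : ℝ) - τ) * S.Ed *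
    ∑ q ∈ (S.Ud ∩ S.pilotSet n).erase n, (∑ j ∈ S.Ad, S.κ j q * S.α j n) ^ 2

/-- Cross-link interference from uplink UEs. -/
def IUE (n : Fin K) : ℝ :=
  ∑ k ∈ S.Uu, S.Eu k * S.ε n k

end CellFree

/-- The random channels and pilot noise: the fast fading entries `h m k i` are `CN(0, 1)`, the
pilot noise entries `W m i t` are `CN(0, N0)`, all of these are mutually independent, and the
inter-UE channels `g n k` are `CN(0, ε n k)`. -/
structure CellFree.IsFading {M K N τ : ℕ} (S : CellFree M K N τ) {Ω : Type*} [MeasurableSpace Ω]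
    (μ : Measure Ω) (h : Fin M → Fin K → Fin N → Ω → ℂ) (W : Fin M → Fin N → Fin τ → Ω → ℂ)
    (g : Fin K → Fin K → Ω → ℂ) : Prop where
  law_h : ∀ m k i, HasLaw (h m k i) (complexNormal 1) μ
  law_W : ∀ m i t, HasLaw (W m i t) (complexNormal S.N0) μ
  indep : iIndepFun
    (fun a : (Fin M × Fin K × Fin N) ⊕ (Fin M × Fin N × Fin τ) =>
      Sum.elim (fun b : Fin M × Fin K × Fin N => h b.1 b.2.1 b.2.2)
        (fun b : Fin M × Fin N × Fin τ => W b.1 b.2.1 b.2.2) a) μ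
  law_g : ∀ n ∈ S.Ud, ∀ k ∈ S.Uu, HasLaw (g n k) (complexNormal (S.ε n k)) μ

end

/-! Fix the UE `n`. Since the pilots are orthonormal, the entries of column `l` of `Z_j` are `CN(0,
pilotVar j l)`, and `pilotVar j (l n) = (c j n)⁻¹`. Write `f_jn = a Z_j e_{l(n)} + e_j`, with `a`
the linear MMSE coefficient. The errors `e_j` are uncorrelated with every entry of every `Z_j'`; all
of these are linear in the same independent circular Gaussians, so they are in fact independent
(`map_linear_pi_complexNormal`, `IsFading.hasLaw_joint`).

The zero-forcing vector `v = Z_j (Z_jᴴ Z_j)⁻¹ e_{l(q)}` satisfies `Z_jᴴ v = e_{l(q)}`. Hence the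
estimated part of `f_jnᴴ p_jq` is almost surely a constant: `a / √(E‖v‖²)` if `n` and `q` share a
pilot, and zero otherwise. The constant needs a diagonal entry of a mean inverse Wishart matrix
(`lintegral_norm_sq_zeroForcing`): `‖v‖⁻²` is the squared distance of one column to the span of the
others, a sum of `N - τ + 1` squared moduli of `CN(0, s)` variables with `s = pilotVar j (l q)`, so
`E‖v‖² = ((N - τ) s)⁻¹`. The constant is thus `√(N - τ) α_jn`.

The remaining part `e_jᴴ p_jq` has mean zero, and its second moment is `β_jn - α_jn²` because the
error is white, independent of the precoder, and `E‖p_jq‖² = 1`. There are no cross terms between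
APs. So `D_nq` is a constant plus a centred error (`IsFading.weightedGain_ae_eq`): the constants
give the numerator and MUI, the errors give EST. -/

/-! ### The complex normal law: characteristic function, linear images, moments. -/

instance isProbabilityMeasure_complexNormal (v : ℝ) : IsProbabilityMeasure (complexNormal v) :=
  Measure.isProbabilityMeasure_map (by
    have : Continuous (fun p : ℝ × ℝ => (⟨p.1, p.2⟩ : ℂ)) :=
      Complex.equivRealProdCLM.symm.continuous
    exact this.aemeasurable)

lemma measurable_complex_mk : Measurable (fun p : ℝ × ℝ => (⟨p.1, p.2⟩ : ℂ)) :=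
  Complex.equivRealProdCLM.symm.continuous.measurable

lemma charFun_complexNormal {v : ℝ} (hv : 0 ≤ v) (ξ : ℂ) :
    charFun (complexNormal v) ξ = Complex.exp (-(v * ‖ξ‖ ^ 2 / 4 : ℝ)) := by
  rw [charFun_apply, complexNormal, integral_map measurable_complex_mk.aemeasurable
    (by fun_prop)]
  have h1 : ∀ p : ℝ × ℝ, Complex.exp (inner ℝ (⟨p.1, p.2⟩ : ℂ) ξ * Complex.I) =
      Complex.exp (p.1 * ξ.re * Complex.I) * Complex.exp (p.2 * ξ.im * Complex.I) := by
    intro p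
    rw [← Complex.exp_add]
    congr 1
    simp [Complex.inner]
    ring
  simp_rw [h1]
  rw [integral_prod_mul (f := fun x : ℝ => Complex.exp (x * ξ.re * Complex.I))
    (g := fun x : ℝ => Complex.exp (x * ξ.im * Complex.I))]
  have h2 : ∀ t : ℝ, ∫ x : ℝ, Complex.exp (x * t * Complex.I) ∂(gaussianReal 0 (v / 2).toNNReal)
      = Complex.exp (-(v * t ^ 2 / 4 : ℝ)) := by
    intro t
    have := charFun_gaussianReal (μ := 0) (v := (v / 2).toNNReal) t
    rw [charFun_apply_real] at this
    have e : ∀ x : ℝ, (x : ℂ) * t * Complex.I = t * x * Complex.I := fun x => by ring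
    simp_rw [e, this]
    congr 1
    rw [Real.coe_toNNReal _ (by positivity)]
    push_cast
    ring
  rw [h2, h2, ← Complex.exp_add]
  congr 1
  rw [Complex.sq_norm, Complex.normSq_apply]
  push_cast
  ring

/-- Uncorrelated linear forms in independent circular Gaussians are independent: the characteristic
function sees `A` only through `A diag(v) Aᴴ`, which `hA` makes diagonal. Circularity is why no
condition on `A diag(v) Aᵀ` appears. -/
lemma map_linear_pi_complexNormal {ι κ : Type*} [Fintype ι] [Fintype κ] [DecidableEq κ]
    {v : ι → ℝ} {w : κ → ℝ} (hv : ∀ i, 0 ≤ v i) (hw : ∀ a, 0 ≤ w a) (A : Matrix κ ι ℂ)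
    (hA : ∀ a b, ∑ i, A a i * v i * star (A b i) = if a = b then (w a : ℂ) else 0) :
    (Measure.pi fun i => complexNormal (v i)).map (fun x => A *ᵥ x) =
      Measure.pi fun a => complexNormal (w a) := by
  have hm : Measurable (fun x : ι → ℂ => A *ᵥ x) := by
    refine measurable_pi_lambda _ fun a => ?_
    simp only [Matrix.mulVec, dotProduct]
    fun_prop
  have : IsProbabilityMeasure
      ((Measure.pi fun i => complexNormal (v i)).map (fun x : ι → ℂ => A *ᵥ x)) :=
    Measure.isProbabilityMeasure_map hm.aemeasurable
  refine charFun_eq_pi_iff.1 ?_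
  intro t
  rw [Measure.map_map (by fun_prop) hm, charFun_apply, integral_map (by fun_prop) (by fun_prop)]
  -- `ξ = Aᴴ t`, so the characteristic function of the image at `t` is that of the product law at
  -- `ξ`.
  set ξ : PiLp 2 (fun _ : ι => ℂ) := WithLp.toLp 2 (fun i => ∑ a, star (A a i) * t a) with hξ
  have h1 := charFun_pi (μ := fun i => complexNormal (v i)) ξ
  rw [charFun_apply, integral_map (by fun_prop) (by fun_prop)] at h1
  have h2 : ∀ x : ι → ℂ, inner ℝ (WithLp.toLp 2 x) ξ =
      inner ℝ (((WithLp.toLp 2) ∘ fun x : ι → ℂ => A *ᵥ x) x) t := by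
    intro x
    simp only [PiLp.inner_apply, hξ, Function.comp, Complex.inner, Matrix.mulVec, dotProduct,
      ← Complex.re_sum, map_sum, Finset.mul_sum, Finset.sum_mul, map_mul]
    rw [Finset.sum_comm]
    congr 1
    refine Finset.sum_congr rfl fun a _ => Finset.sum_congr rfl fun i _ => ?_
    simp only [RCLike.star_def]
    ring
  simp_rw [← h2, h1, charFun_complexNormal (hv _), charFun_complexNormal (hw _),
    ← Complex.exp_sum]
  congr 1
  simp only [Finset.sum_neg_distrib, ← Complex.ofReal_sum]
  congr 2
  simp only [← Finset.sum_div]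
  congr 1
  apply Complex.ofReal_injective
  push_cast
  have h3 : ∀ z : ℂ, (‖z‖ : ℂ) ^ 2 = z * star z := fun z => (Complex.mul_conj' z).symm
  simp_rw [h3]
  have h4 : ∀ i, (v i : ℂ) * (ξ i * star (ξ i)) =
      ∑ a, ∑ b, (A a i * v i * star (A b i)) * (t b * star (t a)) := by
    intro i
    simp only [hξ, star_sum, star_mul', star_star, Finset.mul_sum]
    refine Finset.sum_congr rfl fun a _ => ?_
    rw [Finset.sum_mul, Finset.mul_sum]
    exact Finset.sum_congr rfl fun b _ => by ring
  simp_rw [h4]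
  rw [Finset.sum_comm]
  refine Finset.sum_congr rfl fun a _ => ?_
  rw [Finset.sum_comm]
  simp_rw [← Finset.sum_mul, hA]
  simp

lemma memLp_two_complexNormal (v : ℝ) : MemLp (fun x : ℂ => x) 2 (complexNormal v) := by
  rw [complexNormal, memLp_map_measure_iff (by fun_prop) measurable_complex_mk.aemeasurable]
  have h := memLp_id_gaussianReal' (μ := 0) (v := (v / 2).toNNReal) 2 (by simp)
  have h1 : MemLp (fun p : ℝ × ℝ => p.1) 2
      ((gaussianReal 0 (v / 2).toNNReal).prod (gaussianReal 0 (v / 2).toNNReal)) :=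
    h.comp_measurePreserving measurePreserving_fst
  have h2 : MemLp (fun p : ℝ × ℝ => p.2) 2
      ((gaussianReal 0 (v / 2).toNNReal).prod (gaussianReal 0 (v / 2).toNNReal)) :=
    h.comp_measurePreserving measurePreserving_snd
  have h3 := (h1.ofReal (K := ℂ)).add ((h2.ofReal (K := ℂ)).mul_const Complex.I)
  convert h3 using 1
  funext p
  apply Complex.ext <;> simp [Function.comp]

lemma integral_complexNormal (v : ℝ) : ∫ x, x ∂(complexNormal v) = 0 := by
  rw [complexNormal, integral_map measurable_complex_mk.aemeasurable (by fun_prop)]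
  have h := (memLp_id_gaussianReal' (μ := 0) (v := (v / 2).toNNReal) 2 (by simp)).integrable
    (by norm_num)
  have e : ∀ p : ℝ × ℝ, (⟨p.1, p.2⟩ : ℂ) = ((p.1 : ℝ) : ℂ) + ((p.2 : ℝ) : ℂ) * Complex.I := by
    intro p
    apply Complex.ext <;> simp
  simp_rw [e]
  have h1 : Integrable (fun p : ℝ × ℝ => ((p.1 : ℝ) : ℂ))
      ((gaussianReal 0 (v / 2).toNNReal).prod (gaussianReal 0 (v / 2).toNNReal)) :=
    (h.comp_fst _).ofReal
  have h2 : Integrable (fun p : ℝ × ℝ => ((p.2 : ℝ) : ℂ) * Complex.I)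
      ((gaussianReal 0 (v / 2).toNNReal).prod (gaussianReal 0 (v / 2).toNNReal)) :=
    ((h.comp_snd _).ofReal).mul_const _
  rw [integral_add h1 h2, integral_mul_const, integral_fun_fst (fun x : ℝ => (x : ℂ)),
    integral_fun_snd (fun x : ℝ => (x : ℂ)), integral_complex_ofReal]
  simp

lemma integral_sq_gaussianReal (v : NNReal) : ∫ x, x ^ 2 ∂(gaussianReal 0 v) = v := by
  have h := variance_id_gaussianReal (μ := 0) (v := v)
  rw [variance_eq_integral (by fun_prop)] at h
  simpa using h

lemma integral_norm_sq_complexNormal {v : ℝ} (hv : 0 ≤ v) :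
    ∫ x, ‖x‖ ^ 2 ∂(complexNormal v) = v := by
  rw [complexNormal, integral_map measurable_complex_mk.aemeasurable (by fun_prop)]
  have h := (memLp_id_gaussianReal' (μ := 0) (v := (v / 2).toNNReal) 2 (by simp)).integrable_sq
  have e : ∀ p : ℝ × ℝ, ‖(⟨p.1, p.2⟩ : ℂ)‖ ^ 2 = p.1 ^ 2 + p.2 ^ 2 := by
    intro p
    rw [Complex.sq_norm, Complex.normSq_apply]
    ring
  simp_rw [e]
  have h1 : Integrable (fun p : ℝ × ℝ => p.1 ^ 2)
      ((gaussianReal 0 (v / 2).toNNReal).prod (gaussianReal 0 (v / 2).toNNReal)) :=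
    h.comp_fst _
  have h2 : Integrable (fun p : ℝ × ℝ => p.2 ^ 2)
      ((gaussianReal 0 (v / 2).toNNReal).prod (gaussianReal 0 (v / 2).toNNReal)) :=
    h.comp_snd _
  rw [integral_add h1 h2, integral_fun_fst (fun x : ℝ => x ^ 2),
    integral_fun_snd (fun x : ℝ => x ^ 2), integral_sq_gaussianReal]
  simp only [probReal_univ, one_smul]
  rw [Real.coe_toNNReal _ (by positivity)]
  ring

lemma complexNormal_singleton {v : ℝ} (hv : 0 < v) (z : ℂ) : complexNormal v {z} = 0 := by
  rw [complexNormal, Measure.map_apply measurable_complex_mk (measurableSet_singleton z)]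
  have : NullSingletonClass (gaussianReal 0 (v / 2).toNNReal) :=
    nullSingletonClass_gaussianReal (by simpa using hv)
  refine measure_mono_null (t := {z.re} ×ˢ Set.univ) ?_ ?_
  · rintro p hp
    simp only [Set.mem_preimage, Set.mem_singleton_iff] at hp
    simp [← hp]
  · simp [measure_singleton]

/-! ### Laplace transforms and the inverse moment of a sum of squared moduli. -/

lemma integral_exp_neg_mul_sq_gaussianReal {v : NNReal} (hv : v ≠ 0) {t : ℝ} (ht : 0 ≤ t) :
    ∫ x, Real.exp (-(t * x ^ 2)) ∂(gaussianReal 0 v) = (√(1 + 2 * t * v))⁻¹ := by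
  have hv' : (0 : ℝ) < v := by positivity
  rw [integral_gaussianReal_eq_integral_smul hv]
  have e : ∀ x : ℝ, gaussianPDFReal 0 v x • Real.exp (-(t * x ^ 2)) =
      (√(2 * Real.pi * v))⁻¹ * Real.exp (-((1 + 2 * t * v) / (2 * v)) * x ^ 2) := by
    intro x
    rw [gaussianPDFReal, smul_eq_mul, mul_assoc, ← Real.exp_add]
    congr 2
    field_simp
    ring
  simp_rw [e]
  rw [integral_const_mul, integral_gaussian, ← Real.sqrt_inv, ← Real.sqrt_inv,
    ← Real.sqrt_mul (by positivity)]
  congr 1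
  have := Real.pi_pos
  field_simp

lemma integral_exp_neg_mul_norm_sq_complexNormal {s t : ℝ} (hs : 0 < s) (ht : 0 ≤ t) :
    ∫ x, Real.exp (-(t * ‖x‖ ^ 2)) ∂(complexNormal s) = (1 + t * s)⁻¹ := by
  rw [complexNormal, integral_map measurable_complex_mk.aemeasurable (by fun_prop)]
  have e : ∀ p : ℝ × ℝ, Real.exp (-(t * ‖(⟨p.1, p.2⟩ : ℂ)‖ ^ 2)) =
      Real.exp (-(t * p.1 ^ 2)) * Real.exp (-(t * p.2 ^ 2)) := by
    intro p
    rw [Complex.sq_norm, Complex.normSq_apply, ← Real.exp_add]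
    congr 1
    ring
  simp_rw [e]
  rw [integral_prod_mul (f := fun x : ℝ => Real.exp (-(t * x ^ 2)))
    (g := fun x : ℝ => Real.exp (-(t * x ^ 2))),
    integral_exp_neg_mul_sq_gaussianReal (by simpa using hs) ht,
    Real.coe_toNNReal _ (by positivity), ← mul_inv, Real.mul_self_sqrt (by positivity)]
  congr 1
  ring

lemma lintegral_exp_neg_mul_pi_complexNormal {κ : Type*} [Fintype κ] {s t : ℝ} (hs : 0 < s)
    (ht : 0 ≤ t) :
    ∫⁻ x, ENNReal.ofReal (Real.exp (-(t * ∑ k, ‖x k‖ ^ 2)))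
      ∂(Measure.pi fun _ : κ => complexNormal s) =
      ENNReal.ofReal ((1 + t * s)⁻¹ ^ Fintype.card κ) := by
  rw [← ofReal_integral_eq_lintegral_ofReal]
  · congr 1
    simp_rw [Finset.mul_sum, ← Finset.sum_neg_distrib, Real.exp_sum]
    rw [integral_fintype_prod_eq_pow (fun x : ℂ => Real.exp (-(t * ‖x‖ ^ 2))),
      integral_exp_neg_mul_norm_sq_complexNormal hs ht]
  · refine Integrable.of_bound (C := 1)
      (Measurable.aestronglyMeasurable (by fun_prop)) (Filter.Eventually.of_forall fun x => ?_)
    rw [Real.norm_of_nonneg (Real.exp_nonneg _), Real.exp_le_one_iff, neg_nonpos]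
    positivity
  · exact Filter.Eventually.of_forall fun x => Real.exp_nonneg _

/-- Writing an inverse as an integral of exponentials reduces the inverse moment to a Laplace
transform. Both sides are infinite at `r = 0`, so no null set has to be removed. -/
lemma lintegral_Ioi_exp_neg_mul {r : ℝ} (hr : 0 ≤ r) :
    ∫⁻ t in Set.Ioi (0 : ℝ), ENNReal.ofReal (Real.exp (-(t * r))) = (ENNReal.ofReal r)⁻¹ := by
  rcases hr.eq_or_lt with rfl | hr
  · simp
  · have e : ∀ t : ℝ, -(t * r) = -r * t := fun t => by ring
    simp_rw [e]
    rw [← ofReal_integral_eq_lintegral_ofReal (integrableOn_exp_mul_Ioi (by linarith) 0)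
      (Filter.Eventually.of_forall fun x => Real.exp_nonneg _),
      integral_exp_mul_Ioi (by linarith), ← ENNReal.ofReal_inv_of_pos hr]
    simp

/-- Convergence at infinity needs an exponent of at least two; in the application the exponent is `N
- τ + 1`, which is where `N ≥ τ + 1` enters. -/
lemma lintegral_Ioi_inv_pow {s : ℝ} (hs : 0 < s) (m : ℕ) :
    ∫⁻ t in Set.Ioi (0 : ℝ), ENNReal.ofReal ((1 + t * s)⁻¹ ^ (m + 2)) =
      ENNReal.ofReal (((m + 1) * s)⁻¹) := by
  have hd : ∀ t ∈ Set.Ici (0 : ℝ), HasDerivAt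
      (fun t : ℝ => -((1 + t * s)⁻¹ ^ (m + 1) * ((m + 1) * s)⁻¹)) ((1 + t * s)⁻¹ ^ (m + 2)) t := by
    intro t ht
    have ht' : (0 : ℝ) ≤ t := ht
    have hp : (1 + t * s) ≠ 0 := by positivity
    have h1 : HasDerivAt (fun t : ℝ => 1 + t * s) s t := by
      simpa using ((hasDerivAt_id t).mul_const s).const_add 1
    have h2 := (((h1.inv hp).pow (m + 1)).mul_const (((m : ℝ) + 1) * s)⁻¹).neg
    refine HasDerivAt.congr_deriv (f := fun t : ℝ =>
      -((1 + t * s)⁻¹ ^ (m + 1) * ((m + 1) * s)⁻¹)) h2 ?_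
    simp only [Nat.add_sub_cancel, Pi.inv_apply, inv_pow]
    push_cast
    field_simp
    ring
  have hp : ∀ t ∈ Set.Ioi (0 : ℝ), 0 ≤ (1 + t * s)⁻¹ ^ (m + 2) := by
    intro t ht
    have ht' : (0 : ℝ) < t := ht
    positivity
  have hl : Filter.Tendsto (fun t : ℝ => -((1 + t * s)⁻¹ ^ (m + 1) * ((m + 1) * s)⁻¹))
      Filter.atTop (nhds 0) := by
    have h1 : Filter.Tendsto (fun t : ℝ => 1 + t * s) Filter.atTop Filter.atTop :=
      Filter.tendsto_atTop_add_const_left _ _ (Filter.tendsto_id.atTop_mul_const hs)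
    have h2 := ((h1.inv_tendsto_atTop.pow (m + 1)).mul_const (((m : ℝ) + 1) * s)⁻¹).neg
    simpa using h2
  rw [← ofReal_integral_eq_lintegral_ofReal (integrableOn_Ioi_deriv_of_nonneg' hd hp hl)
    ((ae_restrict_iff' measurableSet_Ioi).2 (Filter.Eventually.of_forall hp)),
    integral_Ioi_of_hasDerivAt_of_nonneg' hd hp hl]
  simp

/-- The mean of an inverse Gamma variable: `E (∑ₖ |xₖ|²)⁻¹ = ((d - 1) s)⁻¹` for `d ≥ 2` independent
`CN(0, s)` variables. -/
lemma lintegral_inv_sum_norm_sq_pi_complexNormal {κ : Type*} [Fintype κ] {s : ℝ} (hs : 0 < s)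
    {m : ℕ} (hκ : Fintype.card κ = m + 2) :
    ∫⁻ x, (ENNReal.ofReal (∑ k, ‖x k‖ ^ 2))⁻¹ ∂(Measure.pi fun _ : κ => complexNormal s) =
      ENNReal.ofReal (((m + 1) * s)⁻¹) := by
  have e : ∀ x : κ → ℂ, (ENNReal.ofReal (∑ k, ‖x k‖ ^ 2))⁻¹ =
      ∫⁻ t in Set.Ioi (0 : ℝ), ENNReal.ofReal (Real.exp (-(t * ∑ k, ‖x k‖ ^ 2))) := fun x =>
    (lintegral_Ioi_exp_neg_mul (by positivity)).symm
  simp_rw [e]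
  rw [lintegral_lintegral_swap (by fun_prop), ← lintegral_Ioi_inv_pow hs m]
  refine setLIntegral_congr_fun measurableSet_Ioi fun t ht => ?_
  rw [lintegral_exp_neg_mul_pi_complexNormal hs (le_of_lt ht), hκ]

/-! ### Projections of Gaussian vectors and almost sure linear independence. -/

section Projection

variable {ι : Type*} [Fintype ι]

/-- The coordinates of an i.i.d. `CN(0, s)` vector in an orthonormal system are i.i.d.
`CN(0, s)`. -/
lemma map_inner_orthonormal_pi_complexNormal {κ : Type*} [Fintype κ] {s : ℝ} (hs : 0 ≤ s)
    {b : κ → EuclideanSpace ℂ ι} (hb : Orthonormal ℂ b) :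
    (Measure.pi fun _ : ι => complexNormal s).map
        (fun z a => inner ℂ (b a) (WithLp.toLp 2 z : EuclideanSpace ℂ ι)) =
      Measure.pi fun _ : κ => complexNormal s := by
  classical
  have h := map_linear_pi_complexNormal (v := fun _ : ι => s) (w := fun _ : κ => s)
    (fun _ => hs) (fun _ => hs) (Matrix.of fun a i => star (b a i)) (by
      intro a c
      have h1 := orthonormal_iff_ite.1 hb a c
      rw [PiLp.inner_apply] at h1
      simp only [Matrix.of_apply, star_star]
      have h2 : ∀ i, star (b a i) * (s : ℂ) * b c i = s * inner ℂ (b a i) (b c i) := by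
        intro i
        simp only [RCLike.inner_apply, RCLike.star_def]
        ring
      simp_rw [h2, ← Finset.mul_sum, h1]
      split_ifs <;> simp)
  rw [← h]
  congr 1
  funext z a
  simp [Matrix.mulVec, dotProduct, PiLp.inner_apply, mul_comm]

lemma measurable_inner_toLp {κ : Type*} (b : κ → EuclideanSpace ℂ ι) :
    Measurable (fun (z : ι → ℂ) a => inner ℂ (b a) (WithLp.toLp 2 z : EuclideanSpace ℂ ι)) := by
  fun_prop

lemma sum_sq_norm_inner_eq_norm_starProjection {E κ : Type*} [NormedAddCommGroup E]
    [InnerProductSpace ℂ E] [Fintype κ] {U : Submodule ℂ E} [U.HasOrthogonalProjection]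
    (b : OrthonormalBasis κ ℂ U) (z : E) :
    ∑ a, ‖inner ℂ (b a : E) z‖ ^ 2 = ‖U.starProjection z‖ ^ 2 := by
  change _ = ‖U.orthogonalProjectionOnto z‖ ^ 2
  rw [← b.sum_sq_norm_inner_right]
  refine Finset.sum_congr rfl fun a _ => ?_
  rw [Submodule.coe_inner, ← Submodule.starProjection_apply,
    ← Submodule.inner_starProjection_left_eq_right,
    Submodule.starProjection_eq_self_iff.2 (b a).2]

/-- The mean inverse squared norm of the projection of an i.i.d. `CN(0, s)` vector to a subspace
of dimension at least two. -/
lemma lintegral_inv_norm_sq_starProjection {s : ℝ} (hs : 0 < s)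
    (U : Submodule ℂ (EuclideanSpace ℂ ι)) {m : ℕ} (hU : Module.finrank ℂ U = m + 2) :
    ∫⁻ z, (ENNReal.ofReal (‖U.starProjection (WithLp.toLp 2 z)‖ ^ 2))⁻¹
      ∂(Measure.pi fun _ : ι => complexNormal s) = ENNReal.ofReal (((m + 1) * s)⁻¹) := by
  set b := stdOrthonormalBasis ℂ U
  have hb : Orthonormal ℂ (fun a => (b a : EuclideanSpace ℂ ι)) :=
    b.orthonormal.comp_linearIsometry U.subtypeₗᵢ
  rw [← lintegral_inv_sum_norm_sq_pi_complexNormal hs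
    (κ := Fin (Module.finrank ℂ U)) (by simpa using hU),
    ← map_inner_orthonormal_pi_complexNormal hs.le hb,
    lintegral_map (by fun_prop) (measurable_inner_toLp _)]
  simp_rw [sum_sq_norm_inner_eq_norm_starProjection b]

/-- The coordinate along a unit vector of `Vᗮ` is `CN(0, s)`, hence almost surely nonzero, while it
vanishes on `V`. -/
lemma ae_notMem_of_finrank_lt {s : ℝ} (hs : 0 < s) (V : Submodule ℂ (EuclideanSpace ℂ ι))
    (hV : Module.finrank ℂ V < Fintype.card ι) :
    ∀ᵐ z ∂(Measure.pi fun _ : ι => complexNormal s), WithLp.toLp 2 z ∉ V := by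
  have h1 := V.finrank_add_finrank_orthogonal
  rw [finrank_euclideanSpace] at h1
  set b := stdOrthonormalBasis ℂ Vᗮ
  have hb : Orthonormal ℂ (fun a => (b a : EuclideanSpace ℂ ι)) :=
    b.orthonormal.comp_linearIsometry Vᗮ.subtypeₗᵢ
  have h2 : ∀ᵐ y ∂(Measure.pi fun _ : Fin (Module.finrank ℂ Vᗮ) => complexNormal s),
      y ⟨0, by omega⟩ ≠ 0 := by
    rw [ae_iff]
    simp only [ne_eq, not_not]
    refine (measurePreserving_eval (fun _ : Fin (Module.finrank ℂ Vᗮ) => complexNormal s)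
      ⟨0, by omega⟩).measure_preimage (measurableSet_singleton (0 : ℂ)).nullMeasurableSet
      |>.trans ?_
    exact complexNormal_singleton hs 0
  rw [← map_inner_orthonormal_pi_complexNormal hs.le hb] at h2
  filter_upwards [ae_of_ae_map (measurable_inner_toLp _).aemeasurable h2] with z hz hzV
  exact hz ((Submodule.mem_orthogonal' _ _).1 (b ⟨0, by omega⟩).2 _ hzV)

/-- Independent Gaussian vectors, at most as many as the dimension, are almost surely linearly
independent. -/
lemma ae_linearIndependent_pi_complexNormal {m : ℕ} (hm : m ≤ Fintype.card ι) {s : Fin m → ℝ}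
    (hs : ∀ l, 0 < s l) :
    ∀ᵐ z ∂(Measure.pi fun l : Fin m => Measure.pi fun _ : ι => complexNormal (s l)),
      LinearIndependent ℂ (fun l => (WithLp.toLp 2 (z l) : EuclideanSpace ℂ ι)) := by
  induction m with
  | zero => exact Filter.Eventually.of_forall fun z => linearIndependent_empty_type
  | succ m ih =>
    have hmp := (measurePreserving_piFinSuccAbove
      (fun l : Fin (m + 1) => Measure.pi fun _ : ι => complexNormal (s l)) 0)
    have hset : ∀ k, MeasurableSet {z : Fin k → ι → ℂ |
        LinearIndependent ℂ (fun l => (WithLp.toLp 2 (z l) : EuclideanSpace ℂ ι))} := by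
      intro k
      have hc : Continuous (fun (z : Fin k → ι → ℂ) l =>
        (WithLp.toLp 2 (z l) : EuclideanSpace ℂ ι)) := by fun_prop
      exact (isOpen_setOfPred_linearIndependent.preimage hc).measurableSet
    have key : ∀ᵐ p ∂((Measure.pi fun _ : ι => complexNormal (s 0)).prod
        (Measure.pi fun l : Fin m => Measure.pi fun _ : ι => complexNormal (s l.succ))),
        LinearIndependent ℂ (fun l => (WithLp.toLp 2
          (((MeasurableEquiv.piFinSuccAbove (fun _ : Fin (m + 1) => ι → ℂ) 0).symm p) l) :
          EuclideanSpace ℂ ι)) := by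
      have hms : MeasurableSet {p : (ι → ℂ) × (Fin m → ι → ℂ) |
          LinearIndependent ℂ (fun l => (WithLp.toLp 2
          (((MeasurableEquiv.piFinSuccAbove (fun _ : Fin (m + 1) => ι → ℂ) 0).symm p) l) :
          EuclideanSpace ℂ ι))} := (MeasurableEquiv.piFinSuccAbove
        (fun _ : Fin (m + 1) => ι → ℂ) 0).symm.measurable (hset (m + 1))
      rw [Measure.ae_prod_iff_ae_ae hms]
      -- Freeze the last `m` vectors: their span has dimension `m < card ι`, so the first vector
      -- almost surely avoids it.
      refine (Measure.ae_ae_comm hms).2 ?_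
      filter_upwards [ih (by omega) (s := fun l => s l.succ) fun l => hs _] with B hB
      have hV : Module.finrank ℂ (Submodule.span ℂ (Set.range fun l =>
          (WithLp.toLp 2 (B l) : EuclideanSpace ℂ ι))) < Fintype.card ι := by
        rw [finrank_span_eq_card hB, Fintype.card_fin]
        omega
      filter_upwards [ae_notMem_of_finrank_lt (hs 0) _ hV] with x hx
      have : (fun l => (WithLp.toLp 2 (((MeasurableEquiv.piFinSuccAbove
          (fun _ : Fin (m + 1) => ι → ℂ) 0).symm (x, B)) l) : EuclideanSpace ℂ ι)) =
          Fin.cons (WithLp.toLp 2 x) (fun l => WithLp.toLp 2 (B l)) := by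
        funext l
        refine Fin.cases ?_ (fun i => ?_) l
        · simp [MeasurableEquiv.piFinSuccAbove_symm_apply, Fin.insertNthEquiv]
        · simp [MeasurableEquiv.piFinSuccAbove_symm_apply, Fin.insertNthEquiv]
      rw [this]
      exact linearIndependent_finCons.2 ⟨hB, hx⟩
    have := hmp.quasiMeasurePreserving.ae key
    simpa only [MeasurableEquiv.symm_apply_apply] using this

end Projection

/-! ### Zero-forcing vectors and the mean of an inverse Wishart diagonal entry. -/

/-- If `v` is orthogonal to `W`, satisfies `⟪x, v⟫ = 1` and lies in `a x + W`, then
`‖v‖² = ‖P x‖⁻²` for the projection `P` onto `Wᗮ`. -/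
lemma norm_sq_eq_inv_norm_sq_starProjection {E : Type*} [NormedAddCommGroup E]
    [InnerProductSpace ℂ E] (W : Submodule ℂ E) [W.HasOrthogonalProjection] {v x y : E} {a : ℂ}
    (hv : v = a • x + y) (hy : y ∈ W) (hvW : v ∈ Wᗮ) (hxv : inner ℂ x v = 1) :
    ‖v‖ ^ 2 = (‖Wᗮ.starProjection x‖ ^ 2)⁻¹ := by
  have h1 : v = a • Wᗮ.starProjection x := by
    conv_lhs => rw [← Submodule.starProjection_eq_self_iff.2 hvW, hv]
    rw [map_add, map_smul, (Submodule.starProjection_apply_eq_zero_iff _).2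
      (W.le_orthogonal_orthogonal hy), add_zero]
  -- With `P` the projection onto `Wᗮ` and `v = a • P x`, the pairing is `1 = ⟪x, v⟫ = ⟪P x, v⟫ = a
  -- ‖P x‖²`.
  have h2 : a * ‖Wᗮ.starProjection x‖ ^ 2 = 1 := by
    rw [← hxv]
    conv_rhs => rw [← Submodule.starProjection_eq_self_iff.2 hvW,
      ← Submodule.inner_starProjection_left_eq_right, h1, inner_smul_right,
      inner_self_eq_norm_sq_to_K]
    rfl
  have h3 : ‖a‖ * ‖Wᗮ.starProjection x‖ ^ 2 = 1 := by
    have := congrArg norm h2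
    simpa using this
  have h4 : ‖Wᗮ.starProjection x‖ ^ 2 ≠ 0 := right_ne_zero_of_mul_eq_one h3
  rw [eq_inv_of_mul_eq_one_left h3 |> fun h => (by rw [h1, norm_smul, mul_pow, h] :
    ‖v‖ ^ 2 = ((‖Wᗮ.starProjection x‖ ^ 2)⁻¹) ^ 2 * ‖Wᗮ.starProjection x‖ ^ 2)]
  field_simp

section ZeroForcing

variable {ι κ : Type*} [Fintype ι] [Fintype κ] [DecidableEq κ]

/-- The zero-forcing vector `Z (Zᴴ Z)⁻¹ e_l`. -/
noncomputable def zeroForcing (Z : Matrix ι κ ℂ) (l : κ) : ι → ℂ :=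
  (Z * (Zᴴ * Z)⁻¹) *ᵥ Pi.single l 1

-- The Gram matrix `Zᴴ Z` has the same kernel as `Z`.
open scoped ComplexOrder in
lemma isUnit_det_conjTranspose_mul_self {Z : Matrix ι κ ℂ}
    (hZ : LinearIndependent ℂ fun l => (WithLp.toLp 2 (Z.col l) : EuclideanSpace ℂ ι)) :
    IsUnit (Zᴴ * Z).det := by
  rw [← Matrix.isUnit_iff_isUnit_det, ← Matrix.mulVec_injective_iff_isUnit,
    ← Matrix.coe_mulVecLin, ← LinearMap.ker_eq_bot, Matrix.ker_mulVecLin_conjTranspose_mul_self,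
    LinearMap.ker_eq_bot, Matrix.coe_mulVecLin, Matrix.mulVec_injective_iff]
  exact hZ.map' (WithLp.linearEquiv 2 ℂ (ι → ℂ)).toLinearMap (LinearEquiv.ker _)

lemma conjTranspose_mulVec_zeroForcing {Z : Matrix ι κ ℂ} (hZ : IsUnit (Zᴴ * Z).det) (l : κ) :
    Zᴴ *ᵥ zeroForcing Z l = Pi.single l 1 := by
  rw [zeroForcing, Matrix.mulVec_mulVec, ← Matrix.mul_assoc, Matrix.mul_nonsing_inv _ hZ,
    Matrix.one_mulVec]

omit [Fintype κ] [DecidableEq κ] in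
lemma inner_col_eq (Z : Matrix ι κ ℂ) (k : κ) (v : ι → ℂ) :
    inner ℂ (WithLp.toLp 2 (Z.col k) : EuclideanSpace ℂ ι) (WithLp.toLp 2 v) = (Zᴴ *ᵥ v) k := by
  simp [PiLp.inner_apply, Matrix.mulVec, dotProduct, mul_comm]

/-- The inverse is the adjugate times the inverse determinant, read as zero where the determinant
vanishes, so measurability holds also at singular Gram matrices. -/
lemma measurable_zeroForcing (l : κ) :
    Measurable fun Z : ι → κ → ℂ => zeroForcing (Matrix.of Z) l := by
  refine measurable_pi_lambda _ fun i => ?_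
  have hc : Continuous fun Z : ι → κ → ℂ => ((Matrix.of Z)ᴴ * Matrix.of Z : Matrix κ κ ℂ) :=
    Continuous.matrix_mul (Continuous.matrix_conjTranspose continuous_id) continuous_id
  simp only [zeroForcing, Matrix.mulVec_single_one, Matrix.col_apply, Matrix.mul_apply,
    Matrix.inv_def, Ring.inverse_eq_inv', Matrix.smul_apply, smul_eq_mul, Matrix.of_apply]
  refine Finset.measurable_sum _ fun k _ => ?_
  have h1 : Measurable fun Z : ι → κ → ℂ => ((Matrix.of Z)ᴴ * Matrix.of Z : Matrix κ κ ℂ).det :=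
    hc.matrix_det.measurable
  have h2 : Measurable fun Z : ι → κ → ℂ =>
      ((Matrix.of Z)ᴴ * Matrix.of Z : Matrix κ κ ℂ).adjugate k l :=
    (hc.matrix_adjugate.matrix_elem k l).measurable
  exact Measurable.mul (by fun_prop) (h1.inv.mul h2)

/-- The zero-forcing vector lies in the column span, is orthogonal to all columns but the `l`-th,
and pairs to one with the `l`-th. These properties fix its norm as the inverse distance of column
`l` to the span of the others. -/
lemma norm_sq_zeroForcing {m : ℕ} {z : Fin (m + 1) → ι → ℂ}
    (hz : LinearIndependent ℂ fun l => (WithLp.toLp 2 (z l) : EuclideanSpace ℂ ι))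
    (l : Fin (m + 1)) :
    ‖(WithLp.toLp 2 (zeroForcing (Matrix.of fun i k => z k i) l) : EuclideanSpace ℂ ι)‖ ^ 2 =
      (‖(Submodule.span ℂ (Set.range fun k => (WithLp.toLp 2 (z (l.succAbove k)) :
        EuclideanSpace ℂ ι)))ᗮ.starProjection (WithLp.toLp 2 (z l))‖ ^ 2)⁻¹ := by
  set Z : Matrix ι (Fin (m + 1)) ℂ := Matrix.of fun i k => z k i with hZ
  have hu : IsUnit (Zᴴ * Z).det := isUnit_det_conjTranspose_mul_self hz
  have hin : ∀ k, inner ℂ (WithLp.toLp 2 (z k) : EuclideanSpace ℂ ι)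
      (WithLp.toLp 2 (zeroForcing Z l)) = (Pi.single l 1 : Fin (m + 1) → ℂ) k := by
    intro k
    rw [← conjTranspose_mulVec_zeroForcing hu l, ← inner_col_eq]
    rfl
  set c : Fin (m + 1) → ℂ := (Zᴴ * Z)⁻¹ *ᵥ Pi.single l 1
  have hv : (WithLp.toLp 2 (zeroForcing Z l) : EuclideanSpace ℂ ι) =
      c l • WithLp.toLp 2 (z l) +
        ∑ k, c (l.succAbove k) • WithLp.toLp 2 (z (l.succAbove k)) := by
    rw [← Fin.sum_univ_succAbove (fun k => c k • (WithLp.toLp 2 (z k) : EuclideanSpace ℂ ι)) l]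
    ext i
    have : zeroForcing Z l = Z *ᵥ c := (Matrix.mulVec_mulVec _ _ _).symm
    simp [this, Z, Matrix.mulVec, dotProduct, mul_comm]
  refine norm_sq_eq_inv_norm_sq_starProjection _ hv ?_ ?_ ?_
  · exact Submodule.sum_mem _ fun k _ => Submodule.smul_mem _ _
      (Submodule.subset_span ⟨k, rfl⟩)
  · rw [← Submodule.span_singleton_le_iff_mem, ← Submodule.le_orthogonal_iff_le_orthogonal]
    rw [Submodule.span_le]
    rintro _ ⟨k, rfl⟩
    rw [SetLike.mem_coe, Submodule.mem_orthogonal_singleton_iff_inner_left, hin]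
    simp [Fin.succAbove_ne]
  · rw [hin]
    simp

/-- The mean squared norm of the zero-forcing vector for independent Gaussian columns, i.e. the
mean of a diagonal entry of an inverse complex Wishart matrix. -/
lemma lintegral_norm_sq_zeroForcing {m r : ℕ} (hr : Fintype.card ι = m + 2 + r)
    {s : Fin (m + 1) → ℝ} (hs : ∀ l, 0 < s l) (l : Fin (m + 1)) :
    ∫⁻ z, ENNReal.ofReal (‖(WithLp.toLp 2 (zeroForcing (Matrix.of fun i k => z k i) l) :
        EuclideanSpace ℂ ι)‖ ^ 2)
      ∂(Measure.pi fun k : Fin (m + 1) => Measure.pi fun _ : ι => complexNormal (s k)) =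
      ENNReal.ofReal (((r + 1) * s l)⁻¹) := by
  have hmp := (measurePreserving_piFinSuccAbove
      (fun k : Fin (m + 1) => Measure.pi fun _ : ι => complexNormal (s k)) l).symm
  have hf : Measurable fun z : Fin (m + 1) → ι → ℂ =>
      ENNReal.ofReal (‖(WithLp.toLp 2 (zeroForcing (Matrix.of fun i k => z k i) l) :
        EuclideanSpace ℂ ι)‖ ^ 2) := by
    have h1 : Measurable fun z : Fin (m + 1) → ι → ℂ => fun (i : ι) k => z k i := by fun_prop
    have h2 := (measurable_zeroForcing (ι := ι) l).comp h1
    have h3 : Measurable fun z : Fin (m + 1) → ι → ℂ =>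
        (WithLp.toLp 2 (zeroForcing (Matrix.of fun i k => z k i) l) : EuclideanSpace ℂ ι) :=
      (WithLp.measurable_toLp 2 _).comp h2
    fun_prop
  have hli := hmp.quasiMeasurePreserving.ae
    (ae_linearIndependent_pi_complexNormal (ι := ι) (by omega) hs)
  rw [← hmp.lintegral_comp hf]
  -- Integrate over column `l` first, with the other columns `B` held fixed.
  refine (lintegral_prod_symm' _ (hf.comp hmp.measurable)).trans ?_
  have hB := ae_linearIndependent_pi_complexNormal (ι := ι) (m := m) (by omega)
    (s := fun k => s (l.succAbove k)) fun k => hs _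
  have hli' := Measure.ae_ae_of_ae_prod (Measure.measurePreserving_swap.quasiMeasurePreserving.ae
    hli)
  have : ∀ᵐ B ∂(Measure.pi fun k : Fin m => Measure.pi fun _ : ι =>
      complexNormal (s (l.succAbove k))),
      ∫⁻ x, ENNReal.ofReal (‖(WithLp.toLp 2 (zeroForcing (Matrix.of fun i k =>
        (MeasurableEquiv.piFinSuccAbove (fun _ : Fin (m + 1) => ι → ℂ) l).symm (x, B) k i) l) :
        EuclideanSpace ℂ ι)‖ ^ 2) ∂(Measure.pi fun _ : ι => complexNormal (s l)) =
      ENNReal.ofReal (((r + 1) * s l)⁻¹) := by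
    filter_upwards [hB, hli'] with B hB hx
    set V := Submodule.span ℂ (Set.range fun k => (WithLp.toLp 2 (B k) : EuclideanSpace ℂ ι))
    have hd : Module.finrank ℂ V = m := by rw [finrank_span_eq_card hB, Fintype.card_fin]
    have hd' := V.finrank_add_finrank_orthogonal
    rw [finrank_euclideanSpace] at hd'
    have hd'' : Module.finrank ℂ Vᗮ = r + 2 :=
      Nat.add_left_cancel (hd'.trans (by rw [hr, hd]; ring) : Module.finrank ℂ V + _ = _)
    rw [← lintegral_inv_norm_sq_starProjection (hs l) Vᗮ (m := r) hd'']
    -- Off `V` the projection is nonzero, so the inverse in `ℝ` and the inverse in `ENNReal`, which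
    -- differ at zero, agree.
    have hV : ∀ᵐ x ∂(Measure.pi fun _ : ι => complexNormal (s l)), WithLp.toLp 2 x ∉ V :=
      ae_notMem_of_finrank_lt (hs l) _ (lt_of_eq_of_lt hd (by omega))
    refine lintegral_congr_ae ?_
    filter_upwards [hx, hV] with x hx hxV
    have h1 := norm_sq_zeroForcing hx l
    simp only [MeasurableEquiv.piFinSuccAbove_symm_apply, Fin.insertNthEquiv, Prod.swap,
      Equiv.coe_fn_mk, Fin.insertNth_apply_same, Fin.insertNth_apply_succAbove] at h1 ⊢
    rw [h1, ENNReal.ofReal_inv_of_pos]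
    have h2 : Vᗮ.starProjection (WithLp.toLp 2 x) ≠ 0 := by
      rw [Ne, Submodule.starProjection_apply_eq_zero_iff, Submodule.orthogonal_orthogonal]
      exact hxV
    positivity
  exact (lintegral_congr_ae this).trans (by simp)

end ZeroForcing

/-! ### Transfer to random matrices on a probability space. -/

lemma hasLaw_pi_pi_of_iIndepFun {Ω ι κ 𝓧 : Type*} [MeasurableSpace Ω] [MeasurableSpace 𝓧]
    [Fintype ι] [Fintype κ] {μ : Measure Ω} {Y : κ → ι → Ω → 𝓧} {ν : κ → ι → Measure 𝓧}
    [∀ l i, IsProbabilityMeasure (ν l i)] (hY : ∀ l i, HasLaw (Y l i) (ν l i) μ)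
    (hind : iIndepFun (fun p : κ × ι => Y p.1 p.2) μ) :
    HasLaw (fun ω l i => Y l i ω) (Measure.pi fun l => Measure.pi fun i => ν l i) μ := by
  have h1 : HasLaw (fun ω (p : κ × ι) => Y p.1 p.2 ω)
      (Measure.pi fun p : κ × ι => ν p.1 p.2) μ := hind.hasLaw_pi fun p => hY _ _
  have h2 : HasLaw (MeasurableEquiv.curry κ ι 𝓧) (Measure.pi fun l => Measure.pi fun i => ν l i)
      (Measure.pi fun p : κ × ι => ν p.1 p.2) := by
    refine ⟨by fun_prop, ?_⟩
    have := Measure.infinitePi_map_curry ν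
    simpa only [Measure.infinitePi_eq_pi] using this
  exact h2.comp h1

lemma lintegral_norm_sq_zeroForcing_of_hasLaw {Ω : Type*} [MeasurableSpace Ω] {μ : Measure Ω}
    {N τ : ℕ} (hN : τ + 1 ≤ N) {s : Fin τ → ℝ} (hs : ∀ l, 0 < s l)
    {Z : Ω → Matrix (Fin N) (Fin τ) ℂ}
    (hZ : HasLaw (fun ω l i => Z ω i l)
      (Measure.pi fun l : Fin τ => Measure.pi fun _ : Fin N => complexNormal (s l)) μ)
    (l : Fin τ) :
    ∫⁻ ω, ENNReal.ofReal (‖(WithLp.toLp 2 (zeroForcing (Z ω) l) :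
        EuclideanSpace ℂ (Fin N))‖ ^ 2) ∂μ = ENNReal.ofReal ((((N : ℝ) - τ) * s l)⁻¹) := by
  -- The index `l` forces `τ > 0`. With `N = τ + 1 + r`, the factor `r + 1` is `N - τ`.
  obtain ⟨m, rfl⟩ : ∃ m, τ = m + 1 := Nat.exists_eq_succ_of_ne_zero (by have := l.2; omega)
  obtain ⟨r, rfl⟩ := Nat.exists_eq_add_of_le hN
  have h := lintegral_norm_sq_zeroForcing (ι := Fin (m + 1 + 1 + r)) (m := m) (r := r)
    (by simp) hs l
  have hf : Measurable fun z : Fin (m + 1) → Fin (m + 1 + 1 + r) → ℂ =>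
      ENNReal.ofReal (‖(WithLp.toLp 2 (zeroForcing (Matrix.of fun i k => z k i) l) :
        EuclideanSpace ℂ (Fin (m + 1 + 1 + r)))‖ ^ 2) := by
    have h1 : Measurable fun z : Fin (m + 1) → Fin (m + 1 + 1 + r) → ℂ =>
      fun i k => z k i := by fun_prop
    have h2 := (WithLp.measurable_toLp 2 _).comp ((measurable_zeroForcing l).comp h1)
    exact (h2.norm.pow_const 2).ennreal_ofReal
  rw [show (((m + 1 + 1 + r : ℕ) : ℝ) - ((m + 1 : ℕ) : ℝ)) = r + 1 by push_cast; ring, ← h]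
  exact hZ.lintegral_comp hf.aemeasurable

lemma ae_linearIndependent_of_hasLaw {Ω : Type*} [MeasurableSpace Ω] {μ : Measure Ω}
    {N τ : ℕ} (hN : τ ≤ N) {s : Fin τ → ℝ} (hs : ∀ l, 0 < s l)
    {Z : Ω → Matrix (Fin N) (Fin τ) ℂ}
    (hZ : HasLaw (fun ω l i => Z ω i l)
      (Measure.pi fun l : Fin τ => Measure.pi fun _ : Fin N => complexNormal (s l)) μ) :
    ∀ᵐ ω ∂μ, IsUnit ((Z ω)ᴴ * Z ω).det := by
  have h := ae_linearIndependent_pi_complexNormal (ι := Fin N) (by simpa using hN) hs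
  rw [← hZ.map_eq] at h
  filter_upwards [ae_of_ae_map hZ.aemeasurable h] with ω hω
  exact isUnit_det_conjTranspose_mul_self hω

/-! ### Inner products of a white vector with an independent vector. -/

section UncorrelatedSum

variable {Ω ι : Type*} [MeasurableSpace Ω] {μ : Measure Ω}
  {F P : ι → Ω → ℂ} {σ : ι → ℝ}

/-- Hölder alone would give only an integrable product; by independence `|f|² |p|²` is a product of
independent integrable variables. -/
lemma memLp_star_mul_of_indepFun {f p : Ω → ℂ} (hf : MemLp f 2 μ) (hp : MemLp p 2 μ)
    (hind : IndepFun f p μ) : MemLp (fun ω => star (f ω) * p ω) 2 μ := by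
  refine (memLp_two_iff_integrable_sq_norm (f := fun ω => star (f ω) * p ω)
    (hf.1.star.mul hp.1)).2 ?_
  have h1 : IndepFun (fun ω => ‖f ω‖ ^ 2) (fun ω => ‖p ω‖ ^ 2) μ :=
    hind.comp (φ := fun z : ℂ => ‖z‖ ^ 2) (ψ := fun z : ℂ => ‖z‖ ^ 2) (by fun_prop) (by fun_prop)
  have h2 := h1.integrable_mul hf.norm.integrable_sq hp.norm.integrable_sq
  refine h2.congr (Filter.Eventually.of_forall fun ω => ?_)
  simp [mul_pow]

lemma indepFun_of_indepFun_pi (hind : IndepFun (fun ω i => F i ω) (fun ω i => P i ω) μ) (i j : ι) :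
    IndepFun (F i) (P j) μ :=
  hind.comp (φ := fun x : ι → ℂ => x i) (ψ := fun x : ι → ℂ => x j)
    (measurable_pi_apply _) (measurable_pi_apply _)

variable [Fintype ι]

lemma memLp_sum_star_mul (hF : ∀ i, MemLp (F i) 2 μ) (hP : ∀ i, MemLp (P i) 2 μ)
    (hind : IndepFun (fun ω i => F i ω) (fun ω i => P i ω) μ) :
    MemLp (fun ω => ∑ i, star (F i ω) * P i ω) 2 μ :=
  memLp_finsetSum _ fun i _ =>
    memLp_star_mul_of_indepFun (hF i) (hP i) (indepFun_of_indepFun_pi hind i i)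

lemma integral_sum_star_mul [IsProbabilityMeasure μ]
    (hF : ∀ i, MemLp (F i) 2 μ) (hP : ∀ i, MemLp (P i) 2 μ)
    (hind : IndepFun (fun ω i => F i ω) (fun ω i => P i ω) μ) (hF0 : ∀ i, ∫ ω, F i ω ∂μ = 0) :
    ∫ ω, ∑ i, star (F i ω) * P i ω ∂μ = 0 := by
  rw [integral_finsetSum _ fun i _ => (memLp_star_mul_of_indepFun (hF i) (hP i)
    (indepFun_of_indepFun_pi hind i i)).integrable (by norm_num)]
  refine Finset.sum_eq_zero fun i _ => ?_
  have h1 : IndepFun (fun ω => star (F i ω)) (P i) μ :=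
    (indepFun_of_indepFun_pi hind i i).comp (φ := fun z : ℂ => star z) (ψ := id)
      (by fun_prop) measurable_id
  rw [h1.integral_fun_mul_eq_mul_integral (hF i).1.star (hP i).1]
  have : ∫ ω, star (F i ω) ∂μ = star (∫ ω, F i ω ∂μ) := integral_conj
  rw [this, hF0, star_zero, zero_mul]

/-- Expand the square. Independence of the two families splits each expectation, and whiteness of
`F` kills the off-diagonal terms, so the `P i` may depend on each other arbitrarily. -/
lemma integral_norm_sq_sum_star_mul [IsProbabilityMeasure μ] [DecidableEq ι]
    (hF : ∀ i, MemLp (F i) 2 μ) (hP : ∀ i, MemLp (P i) 2 μ)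
    (hind : IndepFun (fun ω i => F i ω) (fun ω i => P i ω) μ)
    (hcov : ∀ i j, ∫ ω, star (F i ω) * F j ω ∂μ = if i = j then (σ i : ℂ) else 0) :
    ∫ ω, ‖∑ i, star (F i ω) * P i ω‖ ^ 2 ∂μ = ∑ i, σ i * ∫ ω, ‖P i ω‖ ^ 2 ∂μ := by
  have h3 : ∀ z : ℂ, (‖z‖ : ℂ) ^ 2 = z * star z := fun z => (Complex.mul_conj' z).symm
  apply Complex.ofReal_injective
  rw [← integral_complex_ofReal]
  have e : ∀ ω, ((‖∑ i, star (F i ω) * P i ω‖ ^ 2 : ℝ) : ℂ) =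
      ∑ i, ∑ j, (star (F i ω) * F j ω) * (P i ω * star (P j ω)) := by
    intro ω
    push_cast
    rw [h3, star_sum, Finset.sum_mul_sum]
    refine Finset.sum_congr rfl fun i _ => Finset.sum_congr rfl fun j _ => ?_
    rw [star_mul', star_star]
    ring
  have hI : ∀ i j, IndepFun (fun ω => star (F i ω) * F j ω) (fun ω => P i ω * star (P j ω)) μ :=
    fun i j => hind.comp (φ := fun x : ι → ℂ => star (x i) * x j)
      (ψ := fun x : ι → ℂ => x i * star (x j)) (by fun_prop) (by fun_prop)
  have i1 : ∀ i j, Integrable (fun ω => star (F i ω) * F j ω) μ :=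
    fun i j => (hF i).star.integrable_mul (hF j)
  have i2 : ∀ i j, Integrable (fun ω => P i ω * star (P j ω)) μ :=
    fun i j => (hP i).integrable_mul (hP j).star
  have i3 : ∀ i j, Integrable (fun ω => (star (F i ω) * F j ω) * (P i ω * star (P j ω))) μ :=
    fun i j => (hI i j).integrable_mul (i1 i j) (i2 i j)
  simp_rw [e]
  rw [integral_finsetSum _ fun i _ => integrable_finsetSum _ fun j _ => i3 i j]
  push_cast
  refine Finset.sum_congr rfl fun i _ => ?_
  rw [integral_finsetSum _ fun j _ => i3 i j]
  simp_rw [fun j => (hI i j).integral_fun_mul_eq_mul_integral (i1 i j).1 (i2 i j).1, hcov]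
  simp only [ite_mul, zero_mul, Finset.sum_ite_eq, Finset.mem_univ, if_true]
  congr 1
  rw [← integral_complex_ofReal]
  congr 1
  funext ω
  push_cast
  rw [h3]

end UncorrelatedSum

/-! ### Coefficient rows for antennas, and the covariance algebra of MMSE estimation. -/

/-- The row vector that has the coefficients `u` on the channel entries and `w` on the noise
entries of the antenna `p.2` of the AP `p.1`, and zeros elsewhere. -/
def antennaRow {M K N τ : ℕ} (p : Fin M × Fin N) (u : Fin K → ℂ) (w : Fin τ → ℂ) :
    (Fin M × Fin K × Fin N) ⊕ (Fin M × Fin N × Fin τ) → ℂ :=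
  Sum.elim (fun b => if p = (b.1, b.2.2) then u b.2.1 else 0)
    (fun b => if p = (b.1, b.2.1) then w b.2.2 else 0)

lemma sum_antennaRow_mul {M K N τ : ℕ} (p : Fin M × Fin N) (u : Fin K → ℂ) (w : Fin τ → ℂ)
    (X : (Fin M × Fin K × Fin N) ⊕ (Fin M × Fin N × Fin τ) → ℂ) :
    ∑ a, antennaRow p u w a * X a =
      ∑ k, u k * X (.inl (p.1, k, p.2)) + ∑ t, w t * X (.inr (p.1, p.2, t)) := by
  obtain ⟨j, i⟩ := p
  rw [Fintype.sum_sum_type]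
  congr 1
  · simp only [antennaRow, Sum.elim_inl, Fintype.sum_prod_type, Prod.mk.injEq, ite_and, ite_mul,
      zero_mul]
    rw [Finset.sum_eq_single j (by intro m _ hm; simp [hm.symm]) (by simp)]
    simp
  · simp only [antennaRow, Sum.elim_inr, Fintype.sum_prod_type, Prod.mk.injEq, ite_and, ite_mul,
      zero_mul]
    rw [Finset.sum_eq_single j (by intro m _ hm; simp [hm.symm]) (by simp)]
    simp

lemma sum_antennaRow_mul_star {M K N τ : ℕ} (p p' : Fin M × Fin N) (u u' : Fin K → ℂ)
    (w w' : Fin τ → ℂ) (r : ℝ) :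
    ∑ a, antennaRow p u w a * (Sum.elim (fun _ => 1) (fun _ => r) a : ℝ) *
        star (antennaRow p' u' w' a) =
      if p = p' then ∑ k, u k * star (u' k) + r * ∑ t, w t * star (w' t) else 0 := by
  simp_rw [mul_assoc]
  rw [sum_antennaRow_mul]
  by_cases hp : p = p'
  · subst hp
    simp only [antennaRow, Sum.elim_inl, Sum.elim_inr, if_true, Finset.mul_sum]
    congr 1
    · simp
    · exact Finset.sum_congr rfl fun t _ => by ring
  · simp [antennaRow, hp, Ne.symm hp]

namespace CellFree

variable {M K N τ : ℕ} (S : CellFree M K N τ)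

/-- The variance of the entries of the `l`-th column of `Z_j`. -/
noncomputable def pilotVar (j : Fin M) (l : Fin τ) : ℝ :=
  ∑ k, (if S.l k = l then τ * S.Ep k * S.β j k else 0) + S.N0

lemma pilotVar_pos (j : Fin M) (l : Fin τ) : 0 < S.pilotVar j l := by
  refine add_pos_of_nonneg_of_pos (Finset.sum_nonneg fun k _ => ?_) S.N0_pos
  have := S.Ep_nonneg k
  have := (S.β_pos j k).le
  split_ifs <;> positivity

lemma c_eq (j : Fin M) (n : Fin K) : S.c j n = (S.pilotVar j (S.l n))⁻¹ := by
  rw [c, pilotVar, ← Finset.sum_filter]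
  congr 2
  have hn : n ∈ S.pilotSet n := by simp [pilotSet]
  change _ = ∑ k ∈ S.pilotSet n, _
  rw [← Finset.add_sum_erase _ _ hn, Finset.mul_sum]
  congr 1
  exact Finset.sum_congr rfl fun k _ => by ring

/-- The coefficient of the linear MMSE estimate of `f_jn` from the column `l(n)` of `Z_j`. -/
noncomputable def mmseCoeff (n : Fin K) (j : Fin M) : ℝ :=
  S.c j n * √(τ * S.Ep n) * S.β j n

lemma c_nonneg (j : Fin M) (n : Fin K) : 0 ≤ S.c j n := by
  rw [c_eq]
  exact inv_nonneg.2 (S.pilotVar_pos j _).le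

lemma α_sq (j : Fin M) (n : Fin K) :
    S.α j n ^ 2 = S.c j n * τ * S.Ep n * S.β j n ^ 2 := by
  have := S.c_nonneg j n
  have := S.Ep_nonneg n
  rw [α, Real.sq_sqrt (by positivity)]

/-- The normal equation of linear estimation: the right side is the covariance of a channel entry
with its pilot observation. -/
lemma mmseCoeff_mul_pilotVar (n : Fin K) (j : Fin M) :
    S.mmseCoeff n j * S.pilotVar j (S.l n) = √(τ * S.Ep n) * S.β j n := by
  rw [mmseCoeff, c_eq]
  have := (S.pilotVar_pos j (S.l n)).ne'
  field_simp

lemma mmseCoeff_mul (n : Fin K) (j : Fin M) :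
    S.mmseCoeff n j * (√(τ * S.Ep n) * S.β j n) = S.α j n ^ 2 := by
  have h := Real.mul_self_sqrt (mul_nonneg (Nat.cast_nonneg τ) (S.Ep_nonneg n))
  rw [mmseCoeff, α_sq]
  linear_combination (S.c j n * S.β j n ^ 2) * h

lemma mmseCoeff_mul_sqrt_pilotVar (n : Fin K) (j : Fin M) :
    S.mmseCoeff n j * √(S.pilotVar j (S.l n)) = S.α j n := by
  have h0 := S.c_nonneg j n
  have h1 := (S.β_pos j n).le
  have h2 : 0 ≤ S.mmseCoeff n j := by unfold mmseCoeff; positivity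
  refine (sq_eq_sq₀ (by positivity) (Real.sqrt_nonneg _)).1 ?_
  rw [mul_pow,
    Real.sq_sqrt (S.pilotVar_pos j _).le, sq, mul_assoc, mmseCoeff_mul_pilotVar, mmseCoeff_mul]
  rfl

/-- The pilot variance contains the term of UE `n` itself. The bound makes the error variance `β -
α²` a legitimate parameter of `complexNormal`. -/
lemma α_sq_le (j : Fin M) (n : Fin K) : S.α j n ^ 2 ≤ S.β j n := by
  have hβ := S.β_pos j n
  have h1 : τ * S.Ep n * S.β j n ≤ S.pilotVar j (S.l n) := by
    have h2 : (if S.l n = S.l n then τ * S.Ep n * S.β j n else 0) ≤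
        ∑ k, (if S.l k = S.l n then τ * S.Ep k * S.β j k else 0) :=
      Finset.single_le_sum (f := fun k => if S.l k = S.l n then τ * S.Ep k * S.β j k else 0)
        (fun k _ => by
        have := S.Ep_nonneg k
        have := (S.β_pos j k).le
        split_ifs <;> positivity) (Finset.mem_univ n)
    rw [if_pos rfl] at h2
    have := S.N0_pos
    unfold pilotVar
    linarith
  rw [α_sq, c_eq]
  have hp := S.pilotVar_pos j (S.l n)
  rw [show (S.pilotVar j (S.l n))⁻¹ * τ * S.Ep n * S.β j n ^ 2 =
    (τ * S.Ep n * S.β j n / S.pilotVar j (S.l n)) * S.β j n by field_simp]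
  exact mul_le_of_le_one_left hβ.le ((div_le_one hp).2 h1)

/-- Channel coefficients of the column `l` of `Z_j`. -/
noncomputable def pilotCoeff (j : Fin M) (l : Fin τ) (k : Fin K) : ℂ :=
  if S.l k = l then ((√(τ * S.Ep k) * √(S.β j k) : ℝ) : ℂ) else 0

variable {Ω : Type*} (h : Fin M → Fin K → Fin N → Ω → ℂ) (W : Fin M → Fin N → Fin τ → Ω → ℂ)

lemma sum_star_mul_pilot (l l' : Fin τ) :
    ∑ t, star (S.φ l t) * S.φ l' t = if l = l' then 1 else 0 := by
  have h1 := orthonormal_iff_ite.1 S.φ_orthonormal l l'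
  rw [PiLp.inner_apply] at h1
  rw [← h1]
  exact Finset.sum_congr rfl fun t _ => by simp [mul_comm]

/-- Correlating with `φ_l` removes every UE on another pilot, by orthonormality. -/
lemma Z_apply (j : Fin M) (ω : Ω) (i : Fin N) (l : Fin τ) :
    S.Z h W j ω i l = ∑ k, S.pilotCoeff j l k * h j k i ω + ∑ t, star (S.φ l t) * W j i t ω := by
  simp only [Z, pilotRx, Matrix.mul_apply, Matrix.add_apply, Matrix.sum_apply, Matrix.smul_apply,
    Matrix.of_apply, Matrix.vecMulVec_apply, chan, smul_eq_mul, add_mul, Finset.sum_add_distrib,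
    Finset.sum_mul]
  congr 1
  · rw [Finset.sum_comm]
    refine Finset.sum_congr rfl fun k _ => ?_
    have h1 := S.sum_star_mul_pilot l (S.l k)
    have h2 : ∀ t, (√(τ * S.Ep k) : ℂ) * (√(S.β j k) * h j k i ω * S.φ (S.l k) t) *
        star (S.φ l t) = (√(τ * S.Ep k) : ℂ) * √(S.β j k) * h j k i ω *
          (star (S.φ l t) * S.φ (S.l k) t) := fun t => by ring
    simp_rw [h2]
    rw [← Finset.mul_sum, h1, pilotCoeff]
    by_cases hl : S.l k = l
    · simp [hl]
    · simp [hl, Ne.symm hl]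
  · exact Finset.sum_congr rfl fun t _ => mul_comm _ _

/-- The error of the linear MMSE estimate of the channel of UE `n`, at an antenna of an AP. -/
noncomputable def estErr (n : Fin K) (p : Fin M × Fin N) (ω : Ω) : ℂ :=
  S.chan h p.1 n ω p.2 - S.mmseCoeff n p.1 * S.Z h W p.1 ω p.2 (S.l n)

/-- Channel coefficients of the estimation error and of the columns of `Z_j`. -/
noncomputable def jointChanCoeff (n : Fin K) (j : Fin M) : Option (Fin τ) → Fin K → ℂ
  | none => fun k => (if k = n then (√(S.β j n) : ℂ) else 0) -
      S.mmseCoeff n j * S.pilotCoeff j (S.l n) k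
  | some l => S.pilotCoeff j l

/-- Noise coefficients of the estimation error and of the columns of `Z_j`. -/
noncomputable def jointNoiseCoeff (n : Fin K) (j : Fin M) : Option (Fin τ) → Fin τ → ℂ
  | none => fun t => -(S.mmseCoeff n j * star (S.φ (S.l n) t))
  | some l => fun t => star (S.φ l t)

/-- The estimation errors and the entries of all `Z_j`. -/
noncomputable def joint (n : Fin K) (a : (Fin M × Fin N) × Option (Fin τ)) (ω : Ω) : ℂ :=
  a.2.elim (S.estErr h W n a.1 ω) fun l => S.Z h W a.1.1 ω a.1.2 l

/-- The variances of `CellFree.joint`. -/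
noncomputable def jointVar (n : Fin K) (j : Fin M) : Option (Fin τ) → ℝ
  | none => S.β j n - S.α j n ^ 2
  | some l => S.pilotVar j l

lemma jointVar_nonneg (n : Fin K) (j : Fin M) (o : Option (Fin τ)) : 0 ≤ S.jointVar n j o := by
  cases o with
  | none => exact sub_nonneg.2 (S.α_sq_le j n)
  | some l => exact (S.pilotVar_pos j l).le

lemma joint_eq (n : Fin K) (a : (Fin M × Fin N) × Option (Fin τ)) (ω : Ω) :
    S.joint h W n a ω = ∑ k, S.jointChanCoeff n a.1.1 a.2 k * h a.1.1 k a.1.2 ω +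
      ∑ t, S.jointNoiseCoeff n a.1.1 a.2 t * W a.1.1 a.1.2 t ω := by
  obtain ⟨⟨j, i⟩, _ | l⟩ := a
  · simp only [joint, Option.elim_none, estErr, Z_apply, jointChanCoeff, jointNoiseCoeff, sub_mul,
      Finset.sum_sub_distrib, neg_mul, Finset.sum_neg_distrib, mul_add, Finset.mul_sum, mul_assoc,
      ite_mul, zero_mul, Finset.sum_ite_eq', Finset.mem_univ, if_true, chan]
    ring
  · simp only [joint, Option.elim_some, Z_apply, jointChanCoeff, jointNoiseCoeff]

lemma sum_pilotCoeff_mul_star (j : Fin M) (l l' : Fin τ) :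
    ∑ k, S.pilotCoeff j l k * star (S.pilotCoeff j l' k) +
      S.N0 * ∑ t, star (S.φ l t) * star (star (S.φ l' t)) =
      if l = l' then (S.pilotVar j l : ℂ) else 0 := by
  simp_rw [star_star]
  rw [S.sum_star_mul_pilot]
  by_cases hl : l = l'
  · subst hl
    rw [if_pos rfl, if_pos rfl, pilotVar]
    push_cast
    rw [mul_one]
    congr 1
    refine Finset.sum_congr rfl fun k _ => ?_
    rw [pilotCoeff]
    split_ifs
    · have h1 := Real.mul_self_sqrt (mul_nonneg (Nat.cast_nonneg τ) (S.Ep_nonneg k))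
      have h2 := Real.mul_self_sqrt (S.β_pos j k).le
      rw [RCLike.star_def, Complex.conj_ofReal]
      rw [← Complex.ofReal_mul, show √(τ * S.Ep k) * √(S.β j k) * (√(τ * S.Ep k) * √(S.β j k)) =
        τ * S.Ep k * S.β j k by linear_combination (√(S.β j k) * √(S.β j k)) * h1 +
          (τ * S.Ep k) * h2]
    · simp
  · rw [if_neg hl, if_neg hl, mul_zero, add_zero]
    refine Finset.sum_eq_zero fun k _ => ?_
    simp only [pilotCoeff]
    split_ifs with h1 h2
    · exact absurd (h1.symm.trans h2) hl
    all_goals simp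

lemma sqrt_β_mul_star_pilotCoeff (n : Fin K) (j : Fin M) (l : Fin τ) :
    (√(S.β j n) : ℂ) * star (S.pilotCoeff j l n) =
      if S.l n = l then ((√(τ * S.Ep n) * S.β j n : ℝ) : ℂ) else 0 := by
  rw [pilotCoeff]
  split_ifs
  · have h2 := Real.mul_self_sqrt (S.β_pos j n).le
    rw [RCLike.star_def, Complex.conj_ofReal, ← Complex.ofReal_mul]
    congr 1
    linear_combination √(τ * S.Ep n) * h2
  · simp

/-- The orthogonality principle. For another pilot both the channel and its estimate are
uncorrelated with column `l`; for the pilot of `n` the two covariances cancel by the normal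
equation. -/
lemma jointCoeff_cov_none_some (n : Fin K) (j : Fin M) (l : Fin τ) :
    ∑ k, S.jointChanCoeff n j none k * star (S.pilotCoeff j l k) +
      S.N0 * ∑ t, S.jointNoiseCoeff n j none t * star (star (S.φ l t)) = 0 := by
  have h1 := S.sum_pilotCoeff_mul_star j (S.l n) l
  have h2 := S.sqrt_β_mul_star_pilotCoeff n j l
  have h3 : ((S.mmseCoeff n j * S.pilotVar j (S.l n) : ℝ) : ℂ) =
    ((√(τ * S.Ep n) * S.β j n : ℝ) : ℂ) := congrArg _ (S.mmseCoeff_mul_pilotVar n j)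
  simp only [jointChanCoeff, jointNoiseCoeff, sub_mul, Finset.sum_sub_distrib, neg_mul,
    Finset.sum_neg_distrib, mul_assoc, ← Finset.mul_sum, ite_mul, zero_mul, Finset.sum_ite_eq',
    Finset.mem_univ, if_true]
  rw [h2]
  have h4 : (S.mmseCoeff n j : ℂ) * (if S.l n = l then (S.pilotVar j (S.l n) : ℂ) else 0) =
      if S.l n = l then ((√(τ * S.Ep n) * S.β j n : ℝ) : ℂ) else 0 := by
    rw [← h3]
    split_ifs <;> simp
  linear_combination (-(S.mmseCoeff n j : ℂ)) * h1 - h4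

lemma jointCoeff_cov_none_none (n : Fin K) (j : Fin M) :
    ∑ k, S.jointChanCoeff n j none k * star (S.jointChanCoeff n j none k) +
      S.N0 * ∑ t, S.jointNoiseCoeff n j none t * star (S.jointNoiseCoeff n j none t) =
      ((S.β j n - S.α j n ^ 2 : ℝ) : ℂ) := by
  have h1 := S.jointCoeff_cov_none_some n j (S.l n)
  have h2 := S.sqrt_β_mul_star_pilotCoeff n j (S.l n)
  have h3 := S.mmseCoeff_mul n j
  have h4 := Real.mul_self_sqrt (S.β_pos j n).le
  -- Only the conjugated error is expanded, as channel minus estimate. The error is orthogonal to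
  -- the estimate, so its covariance with the channel, `β - α²`, is all that is left.
  have e1 : ∀ k, S.jointChanCoeff n j none k * star (S.jointChanCoeff n j none k) =
      (if k = n then S.jointChanCoeff n j none k * √(S.β j n) else 0) -
        S.mmseCoeff n j * (S.jointChanCoeff n j none k * star (S.pilotCoeff j (S.l n) k)) := by
    intro k
    have : star (S.jointChanCoeff n j none k) = (if k = n then (√(S.β j n) : ℂ) else 0) -
        S.mmseCoeff n j * star (S.pilotCoeff j (S.l n) k) := by
      simp only [jointChanCoeff, star_sub, star_mul']
      split_ifs <;> simp
    rw [this]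
    split_ifs <;> ring
  have e2 : ∀ t, S.jointNoiseCoeff n j none t * star (S.jointNoiseCoeff n j none t) =
      -(S.mmseCoeff n j * (S.jointNoiseCoeff n j none t * star (star (S.φ (S.l n) t)))) := by
    intro t
    have : star (S.jointNoiseCoeff n j none t) =
        -(S.mmseCoeff n j * star (star (S.φ (S.l n) t))) := by
      simp [jointNoiseCoeff]
    rw [this]
    ring
  simp_rw [e1, e2]
  rw [Finset.sum_sub_distrib, Finset.sum_neg_distrib, ← Finset.mul_sum, ← Finset.mul_sum,
    Finset.sum_ite_eq' , if_pos (Finset.mem_univ _)]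
  have e3 : S.jointChanCoeff n j none n * √(S.β j n) = ((S.β j n - S.α j n ^ 2 : ℝ) : ℂ) := by
    have h5 : star (S.pilotCoeff j (S.l n) n) = S.pilotCoeff j (S.l n) n := by
      simp [pilotCoeff]
    rw [if_pos rfl, h5] at h2
    simp only [jointChanCoeff, if_true, sub_mul]
    rw [mul_assoc, mul_comm (S.pilotCoeff j (S.l n) n), h2, ← h3, ← Complex.ofReal_mul, h4]
    push_cast
    ring
  rw [e3]
  linear_combination (-(S.mmseCoeff n j : ℂ)) * h1

lemma jointCoeff_cov (n : Fin K) (j : Fin M) (o o' : Option (Fin τ)) :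
    ∑ k, S.jointChanCoeff n j o k * star (S.jointChanCoeff n j o' k) +
      S.N0 * ∑ t, S.jointNoiseCoeff n j o t * star (S.jointNoiseCoeff n j o' t) =
      if o = o' then (S.jointVar n j o : ℂ) else 0 := by
  rcases o with _ | l <;> rcases o' with _ | l'
  · rw [if_pos rfl]
    exact S.jointCoeff_cov_none_none n j
  · rw [if_neg (by simp)]
    exact S.jointCoeff_cov_none_some n j l'
  · rw [if_neg (by simp)]
    have h1 := congrArg star (S.jointCoeff_cov_none_some n j l)
    simp only [star_add, star_sum, star_mul', star_star, star_zero,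
      show star (S.N0 : ℂ) = S.N0 from Complex.conj_ofReal _] at h1
    rw [← h1]
    congr 1
    · exact Finset.sum_congr rfl fun k _ => mul_comm _ _
    · congr 1
      exact Finset.sum_congr rfl fun t _ => mul_comm _ _
  · simp only [Option.some.injEq]
    exact S.sum_pilotCoeff_mul_star j l l'

/-! ### Joint law of the estimation errors and the pilot observations. -/

variable {S h W} [MeasurableSpace Ω] {μ : Measure Ω} {g : Fin K → Fin K → Ω → ℂ}

/-- The estimation errors and the entries of all `Z_j` are independent complex Gaussians. -/
lemma IsFading.hasLaw_joint (hS : S.IsFading μ h W g) (n : Fin K) :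
    HasLaw (fun ω a => S.joint h W n a ω)
      (Measure.pi fun a : (Fin M × Fin N) × Option (Fin τ) =>
        complexNormal (S.jointVar n a.1.1 a.2)) μ := by
  have h1 : HasLaw (fun ω (a : (Fin M × Fin K × Fin N) ⊕ (Fin M × Fin N × Fin τ)) =>
      Sum.elim (fun b : Fin M × Fin K × Fin N => h b.1 b.2.1 b.2.2)
        (fun b : Fin M × Fin N × Fin τ => W b.1 b.2.1 b.2.2) a ω)
      (Measure.pi fun a => complexNormal (Sum.elim (fun _ => 1) (fun _ => S.N0) a)) μ := by
    refine hS.indep.hasLaw_pi fun a => ?_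
    rcases a with b | b
    · exact hS.law_h _ _ _
    · exact hS.law_W _ _ _
  -- Errors and pilot observations of all APs form one linear image of the fading and noise entries.
  -- Rows of different antennas have disjoint supports; rows of the same antenna are handled by
  -- `jointCoeff_cov`.
  set A : Matrix ((Fin M × Fin N) × Option (Fin τ))
    ((Fin M × Fin K × Fin N) ⊕ (Fin M × Fin N × Fin τ)) ℂ := Matrix.of fun a =>
      antennaRow a.1 (S.jointChanCoeff n a.1.1 a.2) (S.jointNoiseCoeff n a.1.1 a.2) with hA
  have h2 := map_linear_pi_complexNormal
    (v := (Sum.elim (fun _ => 1) (fun _ => S.N0) :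
      (Fin M × Fin K × Fin N) ⊕ (Fin M × Fin N × Fin τ) → ℝ))
    (w := fun a : (Fin M × Fin N) × Option (Fin τ) => S.jointVar n a.1.1 a.2)
    (by rintro (b | b) <;> simp [S.N0_pos.le]) (fun a => S.jointVar_nonneg n _ _) A (by
      intro a b
      simp only [hA, Matrix.of_apply]
      rw [sum_antennaRow_mul_star]
      obtain ⟨p, o⟩ := a
      obtain ⟨p', o'⟩ := b
      by_cases hp : p = p'
      · subst hp
        rw [if_pos rfl, S.jointCoeff_cov]
        simp
      · simp [hp])
  have h3 : HasLaw (fun x => A *ᵥ x) (Measure.pi fun a : (Fin M × Fin N) × Option (Fin τ) =>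
        complexNormal (S.jointVar n a.1.1 a.2))
      (Measure.pi fun a => complexNormal (Sum.elim (fun _ => 1) (fun _ => S.N0) a)) := by
    refine ⟨Measurable.aemeasurable (measurable_pi_lambda _ fun a => ?_), h2⟩
    simp only [Matrix.mulVec, dotProduct]
    fun_prop
  convert h3.comp h1 using 1
  funext ω a
  simp only [Function.comp, Matrix.mulVec, dotProduct, hA, Matrix.of_apply]
  rw [sum_antennaRow_mul, joint_eq]
  rfl

end CellFree

lemma memLp_two_of_hasLaw_complexNormal {Ω : Type*} [MeasurableSpace Ω] {μ : Measure Ω} {X : Ω → ℂ}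
    {v : ℝ} (hX : HasLaw X (complexNormal v) μ) : MemLp X 2 μ := by
  have h1 := memLp_two_complexNormal v
  rw [← hX.map_eq] at h1
  exact (memLp_map_measure_iff (by fun_prop) hX.aemeasurable).1 h1

lemma integral_norm_sq_of_hasLaw_complexNormal {Ω : Type*} [MeasurableSpace Ω] {μ : Measure Ω}
    {X : Ω → ℂ} {v : ℝ} (hv : 0 ≤ v) (hX : HasLaw X (complexNormal v) μ) :
    ∫ ω, ‖X ω‖ ^ 2 ∂μ = v :=
  (hX.integral_comp (f := fun z : ℂ => ‖z‖ ^ 2)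
    (Measurable.aestronglyMeasurable (by fun_prop))).trans (integral_norm_sq_complexNormal hv)

/-! ### Moments of the precoders and of the effective gains. -/

namespace CellFree

variable {M K N τ : ℕ} {S : CellFree M K N τ} {Ω : Type*} [MeasurableSpace Ω] {μ : Measure Ω}
  {h : Fin M → Fin K → Fin N → Ω → ℂ} {W : Fin M → Fin N → Fin τ → Ω → ℂ}
  {g : Fin K → Fin K → Ω → ℂ}

lemma IsFading.hasLaw_joint_apply (hS : S.IsFading μ h W g) (n : Fin K)
    (a : (Fin M × Fin N) × Option (Fin τ)) :
    HasLaw (S.joint h W n a) (complexNormal (S.jointVar n a.1.1 a.2)) μ :=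
  (measurePreserving_eval _ a).hasLaw.comp (hS.hasLaw_joint n)

lemma IsFading.hasLaw_estErr (hS : S.IsFading μ h W g) (n : Fin K) (p : Fin M × Fin N) :
    HasLaw (S.estErr h W n p) (complexNormal (S.β p.1 n - S.α p.1 n ^ 2)) μ :=
  hS.hasLaw_joint_apply n (p, none)

section

variable [IsProbabilityMeasure μ]

lemma IsFading.iIndepFun_joint (hS : S.IsFading μ h W g) (n : Fin K) :
    iIndepFun (S.joint h W n) μ :=
  (iIndepFun_iff_hasLaw_pi_pi fun a => hS.hasLaw_joint_apply n a).2 (hS.hasLaw_joint n)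

lemma IsFading.hasLaw_Z (hS : S.IsFading μ h W g) (n : Fin K) (j : Fin M) :
    HasLaw (fun ω l i => S.Z h W j ω i l)
      (Measure.pi fun l : Fin τ => Measure.pi fun _ : Fin N => complexNormal (S.pilotVar j l)) μ := by
  have h1 : Function.Injective (fun p : Fin τ × Fin N => (((j, p.2), some p.1) :
      (Fin M × Fin N) × Option (Fin τ))) := by
    rintro ⟨l, i⟩ ⟨l', i'⟩ hp
    simp only [Prod.mk.injEq, true_and, Option.some.injEq] at hp
    simp [hp]
  exact hasLaw_pi_pi_of_iIndepFun (Y := fun l i ω => S.Z h W j ω i l)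
    (ν := fun l _ => complexNormal (S.pilotVar j l))
    (fun l i => hS.hasLaw_joint_apply n ((j, i), some l)) ((hS.iIndepFun_joint n).precomp h1)

lemma IsFading.aemeasurable_zfDir (hS : S.IsFading μ h W g) (j : Fin M) (q : Fin K) :
    AEMeasurable (S.zfDir h W j q) μ := by
  have h1 : Measurable fun z : Fin τ → Fin N → ℂ => fun i l => z l i := by fun_prop
  exact ((measurable_zeroForcing (S.l q)).comp h1).comp_aemeasurable (hS.hasLaw_Z q j).aemeasurable

lemma IsFading.lintegral_zfNormSq (hS : S.IsFading μ h W g) (hN : τ + 1 ≤ N) (j : Fin M)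
    (q : Fin K) :
    ∫⁻ ω, ENNReal.ofReal (S.zfNormSq h W j q ω) ∂μ =
      ENNReal.ofReal ((((N : ℝ) - τ) * S.pilotVar j (S.l q))⁻¹) :=
  lintegral_norm_sq_zeroForcing_of_hasLaw hN (S.pilotVar_pos j) (hS.hasLaw_Z q j) (S.l q)

omit [MeasurableSpace Ω] in
lemma zfNormSq_nonneg (j : Fin M) (q : Fin K) (ω : Ω) : 0 ≤ S.zfNormSq h W j q ω := sq_nonneg _

lemma IsFading.aemeasurable_zfNormSq (hS : S.IsFading μ h W g) (j : Fin M) (q : Fin K) :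
    AEMeasurable (S.zfNormSq h W j q) μ :=
  ((WithLp.measurable_toLp 2 _).comp_aemeasurable (hS.aemeasurable_zfDir j q)).norm.pow_const 2

lemma IsFading.integrable_zfNormSq (hS : S.IsFading μ h W g) (hN : τ + 1 ≤ N) (j : Fin M)
    (q : Fin K) : Integrable (S.zfNormSq h W j q) μ := by
  refine ⟨(hS.aemeasurable_zfNormSq j q).aestronglyMeasurable, ?_⟩
  rw [hasFiniteIntegral_iff_ofReal (Filter.Eventually.of_forall fun ω => zfNormSq_nonneg j q ω),
    hS.lintegral_zfNormSq hN]
  exact ENNReal.ofReal_lt_top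

lemma IsFading.integral_zfNormSq (hS : S.IsFading μ h W g) (hN : τ + 1 ≤ N) (j : Fin M)
    (q : Fin K) :
    ∫ ω, S.zfNormSq h W j q ω ∂μ = (((N : ℝ) - τ) * S.pilotVar j (S.l q))⁻¹ := by
  have hN' : (τ : ℝ) + 1 ≤ N := by exact_mod_cast hN
  have h1 := S.pilotVar_pos j (S.l q)
  rw [integral_eq_lintegral_of_nonneg_ae (Filter.Eventually.of_forall fun ω => zfNormSq_nonneg j q ω)
    (hS.aemeasurable_zfNormSq j q).aestronglyMeasurable, hS.lintegral_zfNormSq hN,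
    ENNReal.toReal_ofReal]
  exact inv_nonneg.2 (mul_nonneg (by linarith) h1.le)

lemma IsFading.integral_zfNormSq_pos (hS : S.IsFading μ h W g) (hN : τ + 1 ≤ N) (j : Fin M)
    (q : Fin K) : 0 < ∫ ω, S.zfNormSq h W j q ω ∂μ := by
  have hN' : (τ : ℝ) + 1 ≤ N := by exact_mod_cast hN
  rw [hS.integral_zfNormSq hN]
  exact inv_pos.2 (mul_pos (by linarith) (S.pilotVar_pos j (S.l q)))

omit [MeasurableSpace Ω] in
lemma zfNormSq_eq_sum (j : Fin M) (q : Fin K) (ω : Ω) :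
    S.zfNormSq h W j q ω = ∑ i, ‖S.zfDir h W j q ω i‖ ^ 2 :=
  EuclideanSpace.norm_sq_eq _

omit [IsProbabilityMeasure μ] in
lemma norm_sq_precoder_apply (j : Fin M) (q : Fin K) (ω : Ω) (i : Fin N) :
    ‖S.precoder μ h W j q ω i‖ ^ 2 =
      (∫ ω', S.zfNormSq h W j q ω' ∂μ)⁻¹ * ‖S.zfDir h W j q ω i‖ ^ 2 := by
  have h0 : 0 ≤ ∫ ω', S.zfNormSq h W j q ω' ∂μ := integral_nonneg fun ω => sq_nonneg _
  rw [precoder, Pi.smul_apply, norm_smul, mul_pow, norm_inv, Complex.norm_real, inv_pow,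
    Real.norm_of_nonneg (Real.sqrt_nonneg _), Real.sq_sqrt h0]

lemma IsFading.memLp_zfDir (hS : S.IsFading μ h W g) (hN : τ + 1 ≤ N) (j : Fin M) (q : Fin K)
    (i : Fin N) : MemLp (fun ω => S.zfDir h W j q ω i) 2 μ := by
  have h1 : AEStronglyMeasurable (fun ω => S.zfDir h W j q ω i) μ :=
    ((measurable_pi_apply i).comp_aemeasurable (hS.aemeasurable_zfDir j q)).aestronglyMeasurable
  rw [memLp_two_iff_integrable_sq_norm h1]
  refine (hS.integrable_zfNormSq hN j q).mono' (h1.norm.pow 2)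
    (Filter.Eventually.of_forall fun ω => ?_)
  rw [Real.norm_of_nonneg (sq_nonneg _), zfNormSq_eq_sum]
  exact Finset.single_le_sum (f := fun i => ‖S.zfDir h W j q ω i‖ ^ 2)
    (fun i _ => sq_nonneg _) (Finset.mem_univ i)

lemma IsFading.memLp_precoder (hS : S.IsFading μ h W g) (hN : τ + 1 ≤ N) (j : Fin M) (q : Fin K)
    (i : Fin N) : MemLp (fun ω => S.precoder μ h W j q ω i) 2 μ :=
  (hS.memLp_zfDir hN j q i).const_mul _

lemma IsFading.sum_integral_norm_sq_precoder (hS : S.IsFading μ h W g) (hN : τ + 1 ≤ N)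
    (j : Fin M) (q : Fin K) :
    ∑ i, ∫ ω, ‖S.precoder μ h W j q ω i‖ ^ 2 ∂μ = 1 := by
  simp_rw [norm_sq_precoder_apply, integral_const_mul]
  rw [← Finset.mul_sum, ← integral_finsetSum _ fun i _ =>
    (hS.memLp_zfDir hN j q i).norm.integrable_sq]
  simp_rw [← zfNormSq_eq_sum]
  exact inv_mul_cancel₀ (hS.integral_zfNormSq_pos hN j q).ne'

/-- Errors and precoders are functions of disjoint blocks, the `none` and the `some` indices, of one
independent family. All APs are treated jointly, so that a weighted sum over APs is a single inner
product indexed by AP and antenna. -/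
lemma IsFading.indepFun_estErr_precoder (hS : S.IsFading μ h W g) (n q : Fin K)
    (r : Fin M → ℝ) :
    IndepFun (fun ω p => S.estErr h W n p ω)
      (fun ω (p : Fin M × Fin N) => (r p.1 : ℂ) * S.precoder μ h W p.1 q ω p.2) μ := by
  classical
  set A : Finset ((Fin M × Fin N) × Option (Fin τ)) := Finset.univ.filter fun a => a.2 = none
  set B : Finset ((Fin M × Fin N) × Option (Fin τ)) := Finset.univ.filter fun a => a.2 ≠ none
  have hAB : Disjoint A B := Finset.disjoint_filter_filter_not _ _ _
  have h1 := (hS.iIndepFun_joint n).indepFun_finset₀ A B hAB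
    fun a => (hS.hasLaw_joint_apply n a).aemeasurable
  have hA : ∀ p : Fin M × Fin N, (p, none) ∈ A := fun p => by simp [A]
  have hB : ∀ (p : Fin M × Fin N) l, (p, some l) ∈ B := fun p l => by simp [B]
  refine h1.comp (φ := fun (x : A → ℂ) (p : Fin M × Fin N) => x ⟨(p, none), hA p⟩)
    (ψ := fun (x : B → ℂ) (p : Fin M × Fin N) => (r p.1 : ℂ) * (((√(∫ ω', S.zfNormSq h W p.1 q ω' ∂μ) : ℂ))⁻¹ *
      zeroForcing (Matrix.of fun i l => x ⟨((p.1, i), some l), hB _ _⟩) (S.l q) p.2)) ?_ ?_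
  · fun_prop
  · refine measurable_pi_lambda _ fun p => ?_
    have h2 : Measurable fun (x : B → ℂ) (i : Fin N) (l : Fin τ) =>
      x ⟨((p.1, i), some l), hB _ _⟩ := by fun_prop
    exact (((measurable_pi_apply p.2).comp
      ((measurable_zeroForcing (S.l q)).comp h2)).const_mul _).const_mul _

/-- The contribution of the channel estimation errors to a weighted sum of the gains. -/
noncomputable def errGain (S : CellFree M K N τ) (μ : Measure Ω)
    (h : Fin M → Fin K → Fin N → Ω → ℂ) (W : Fin M → Fin N → Fin τ → Ω → ℂ) (n q : Fin K)
    (r : Fin M → ℝ) (ω : Ω) : ℂ :=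
  ∑ p : Fin M × Fin N, star (S.estErr h W n p ω) *
    ((r p.1 : ℂ) * S.precoder μ h W p.1 q ω p.2)

omit [IsProbabilityMeasure μ] in
lemma IsFading.memLp_estErr (hS : S.IsFading μ h W g) (n : Fin K) (p : Fin M × Fin N) :
    MemLp (S.estErr h W n p) 2 μ :=
  memLp_two_of_hasLaw_complexNormal (hS.hasLaw_estErr n p)

omit [IsProbabilityMeasure μ] in
lemma IsFading.integral_estErr (hS : S.IsFading μ h W g) (n : Fin K) (p : Fin M × Fin N) :
    ∫ ω, S.estErr h W n p ω ∂μ = 0 := by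
  rw [(hS.hasLaw_estErr n p).integral_eq, integral_complexNormal]

lemma IsFading.integral_star_estErr_mul (hS : S.IsFading μ h W g) (n : Fin K)
    (p p' : Fin M × Fin N) :
    ∫ ω, star (S.estErr h W n p ω) * S.estErr h W n p' ω ∂μ =
      if p = p' then ((S.β p.1 n - S.α p.1 n ^ 2 : ℝ) : ℂ) else 0 := by
  split_ifs with hp
  · subst hp
    have h3 : ∀ z : ℂ, star z * z = ((‖z‖ ^ 2 : ℝ) : ℂ) := fun z => by
      rw [mul_comm]
      push_cast
      exact Complex.mul_conj' z
    simp_rw [h3]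
    rw [integral_complex_ofReal, integral_norm_sq_of_hasLaw_complexNormal
      (sub_nonneg.2 (S.α_sq_le _ _)) (hS.hasLaw_estErr n p)]
  · have h1 : IndepFun (S.estErr h W n p) (S.estErr h W n p') μ :=
      (hS.iIndepFun_joint n).indepFun (i := (p, none)) (j := (p', none)) (by simpa using hp)
    have h2 : IndepFun (fun ω => star (S.estErr h W n p ω)) (S.estErr h W n p') μ :=
      h1.comp (φ := fun z : ℂ => star z) (ψ := id) (by fun_prop) measurable_id
    rw [h2.integral_fun_mul_eq_mul_integral (hS.memLp_estErr n p).1.star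
      (hS.memLp_estErr n p').1, hS.integral_estErr, mul_zero]

lemma IsFading.memLp_errGain (hS : S.IsFading μ h W g) (hN : τ + 1 ≤ N) (n q : Fin K)
    (r : Fin M → ℝ) : MemLp (S.errGain μ h W n q r) 2 μ :=
  memLp_sum_star_mul (fun p => hS.memLp_estErr n p)
    (fun p => (hS.memLp_precoder hN p.1 q p.2).const_mul _) (hS.indepFun_estErr_precoder n q r)

lemma IsFading.integral_errGain (hS : S.IsFading μ h W g) (hN : τ + 1 ≤ N) (n q : Fin K)
    (r : Fin M → ℝ) : ∫ ω, S.errGain μ h W n q r ω ∂μ = 0 :=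
  integral_sum_star_mul (fun p => hS.memLp_estErr n p)
    (fun p => (hS.memLp_precoder hN p.1 q p.2).const_mul _) (hS.indepFun_estErr_precoder n q r)
    fun p => hS.integral_estErr n p

/-- The error variance is the same at all antennas of an AP and the precoder has unit mean squared
norm, so the number of antennas drops out. -/
lemma IsFading.integral_norm_sq_errGain (hS : S.IsFading μ h W g) (hN : τ + 1 ≤ N) (n q : Fin K)
    (r : Fin M → ℝ) :
    ∫ ω, ‖S.errGain μ h W n q r ω‖ ^ 2 ∂μ = ∑ j, r j ^ 2 * (S.β j n - S.α j n ^ 2) := by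
  refine (integral_norm_sq_sum_star_mul (fun p => hS.memLp_estErr n p)
    (fun p => (hS.memLp_precoder hN p.1 q p.2).const_mul _) (hS.indepFun_estErr_precoder n q r)
    (hS.integral_star_estErr_mul n)).trans ?_
  rw [Fintype.sum_prod_type]
  refine Finset.sum_congr rfl fun j _ => ?_
  have h1 : ∀ i ω, ‖(r j : ℂ) * S.precoder μ h W j q ω i‖ ^ 2 =
      r j ^ 2 * ‖S.precoder μ h W j q ω i‖ ^ 2 := by
    intro i ω
    rw [norm_mul, mul_pow, Complex.norm_real, Real.norm_eq_abs, sq_abs]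
  simp only [h1, integral_const_mul]
  rw [← Finset.mul_sum, ← Finset.mul_sum, hS.sum_integral_norm_sq_precoder hN]
  ring

/-- The mean of the gain `f_jnᴴ p_jq`. -/
noncomputable def meanGain (S : CellFree M K N τ) (n q : Fin K) (j : Fin M) : ℝ :=
  if S.l n = S.l q then √((N : ℝ) - τ) * S.α j n else 0

/-- Zero forcing makes the estimated part of the channel contribute a deterministic gain wherever
the Gram matrix is invertible, which is almost everywhere; only the estimation error stays random.
-/
lemma IsFading.gain_ae_eq (hS : S.IsFading μ h W g) (hN : τ + 1 ≤ N) (n q : Fin K) (j : Fin M) :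
    ∀ᵐ ω ∂μ, S.gain μ h W n q j ω = S.meanGain n q j +
      ∑ i, star (S.estErr h W n (j, i) ω) * S.precoder μ h W j q ω i := by
  filter_upwards [ae_linearIndependent_of_hasLaw (by omega) (S.pilotVar_pos j)
    (hS.hasLaw_Z n j)] with ω hω
  have h1 : ∀ i, S.chan h j n ω i =
      S.mmseCoeff n j * S.Z h W j ω i (S.l n) + S.estErr h W n (j, i) ω := fun i => by
    rw [estErr]
    ring
  have h2 : ((S.Z h W j ω)ᴴ *ᵥ S.zfDir h W j q ω) (S.l n) = if S.l n = S.l q then 1 else 0 := by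
    have := congrFun (conjTranspose_mulVec_zeroForcing hω (S.l q)) (S.l n)
    rw [Pi.single_apply] at this
    exact this
  have h3 : ∑ i, star (S.Z h W j ω i (S.l n)) * S.precoder μ h W j q ω i =
      ((√(∫ ω', S.zfNormSq h W j q ω' ∂μ) : ℂ))⁻¹ * if S.l n = S.l q then 1 else 0 := by
    rw [← h2]
    simp only [Matrix.mulVec, dotProduct, Matrix.conjTranspose_apply, precoder, Pi.smul_apply,
      smul_eq_mul, Finset.mul_sum]
    exact Finset.sum_congr rfl fun i _ => by ring
  have h4 : S.gain μ h W n q j ω = S.mmseCoeff n j *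
      ∑ i, star (S.Z h W j ω i (S.l n)) * S.precoder μ h W j q ω i +
      ∑ i, star (S.estErr h W n (j, i) ω) * S.precoder μ h W j q ω i := by
    rw [gain, dotProduct, Finset.mul_sum, ← Finset.sum_add_distrib]
    refine Finset.sum_congr rfl fun i _ => ?_
    rw [Pi.star_apply, h1, star_add, star_mul',
      show star (S.mmseCoeff n j : ℂ) = S.mmseCoeff n j from Complex.conj_ofReal _]
    ring
  rw [h4, h3]
  congr 1
  rw [meanGain, hS.integral_zfNormSq hN]
  split_ifs with hl
  -- On a shared pilot, dividing by `√(E‖v‖²)` multiplies the coefficient by `√(N - τ) √pilotVar`,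
  -- and the coefficient times `√pilotVar` is `α`.
  · rw [← S.mmseCoeff_mul_sqrt_pilotVar, hl, Real.sqrt_inv, Complex.ofReal_inv, inv_inv,
      Real.sqrt_mul (by have : (τ : ℝ) + 1 ≤ N := by exact_mod_cast hN
                        linarith)]
    push_cast
    ring
  · simp

lemma IsFading.sum_gain_ae_eq (hS : S.IsFading μ h W g) (hN : τ + 1 ≤ N) (n q : Fin K)
    (r : Fin M → ℝ) :
    (fun ω => ∑ j, (r j : ℂ) * S.gain μ h W n q j ω) =ᵐ[μ]
      fun ω => ((∑ j, r j * S.meanGain n q j : ℝ) : ℂ) + S.errGain μ h W n q r ω := by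
  filter_upwards [ae_all_iff.2 fun j => hS.gain_ae_eq hN n q j] with ω hω
  simp only [hω, mul_add, Finset.sum_add_distrib, errGain, Fintype.sum_prod_type, Finset.mul_sum]
  push_cast
  congr 1
  exact Finset.sum_congr rfl fun j _ => Finset.sum_congr rfl fun i _ => by ring

lemma IsFading.memLp_gain (hS : S.IsFading μ h W g) (hN : τ + 1 ≤ N) (n q : Fin K) (j : Fin M) :
    MemLp (S.gain μ h W n q j) 2 μ := by
  -- Unit weights at `j` isolate the gain of a single AP.
  have h1 := ((memLp_const (((∑ j', (Pi.single j 1 : Fin M → ℝ) j' * S.meanGain n q j' : ℝ) : ℂ))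
    (p := 2) (μ := μ)).add (hS.memLp_errGain hN n q (Pi.single j 1))).ae_eq
    (hS.sum_gain_ae_eq hN n q (Pi.single j 1)).symm
  convert h1 using 1
  funext ω
  rw [Finset.sum_eq_single j (by intro m _ hm; simp [hm]) (by simp)]
  simp

lemma integral_norm_sq_const_add {T : Ω → ℂ} (hT : MemLp T 2 μ) (hT0 : ∫ ω, T ω ∂μ = 0) (a : ℂ) :
    ∫ ω, ‖a + T ω‖ ^ 2 ∂μ = ‖a‖ ^ 2 + ∫ ω, ‖T ω‖ ^ 2 ∂μ := by
  have hi := hT.integrable (by norm_num : (1 : ENNReal) ≤ 2)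
  have h1 : ∀ ω, ‖a + T ω‖ ^ 2 = ‖a‖ ^ 2 + ‖T ω‖ ^ 2 + 2 * inner ℝ a (T ω) := fun ω => by
    rw [norm_add_sq_real]
    ring
  have h2 : Integrable (fun ω => 2 * inner ℝ a (T ω)) μ := (hi.const_inner a).const_mul 2
  simp_rw [h1]
  have h3 : Integrable (fun ω => ‖a‖ ^ 2 + ‖T ω‖ ^ 2) μ :=
    (integrable_const _).add hT.norm.integrable_sq
  rw [integral_add h3 h2, integral_add (integrable_const _) hT.norm.integrable_sq, integral_const_mul,
    integral_inner hi, hT0]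
  simp

/-- The weights of the gains in `CellFree.weightedGain`. -/
noncomputable def weight (S : CellFree M K N τ) (q : Fin K) (j : Fin M) : ℝ :=
  if j ∈ S.Ad then S.κ j q else 0

lemma IsFading.weightedGain_ae_eq (hS : S.IsFading μ h W g) (hN : τ + 1 ≤ N) (n q : Fin K) :
    S.weightedGain μ h W n q =ᵐ[μ]
      fun ω => ((∑ j, S.weight q j * S.meanGain n q j : ℝ) : ℂ) +
        S.errGain μ h W n q (S.weight q) ω := by
  refine Filter.EventuallyEq.trans (Filter.Eventually.of_forall fun ω => ?_)
    (hS.sum_gain_ae_eq hN n q (S.weight q))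
  simp only [weightedGain, weight]
  simp [apply_ite, ite_mul, Finset.sum_ite_mem]

lemma IsFading.integral_weightedGain (hS : S.IsFading μ h W g) (hN : τ + 1 ≤ N) (n q : Fin K) :
    ∫ ω, S.weightedGain μ h W n q ω ∂μ = ((∑ j, S.weight q j * S.meanGain n q j : ℝ) : ℂ) := by
  rw [integral_congr_ae (hS.weightedGain_ae_eq hN n q), integral_add (integrable_const _)
    ((hS.memLp_errGain hN n q _).integrable (by norm_num)), hS.integral_errGain hN]
  simp

lemma sum_weight_sq (n q : Fin K) :
    ∑ j, S.weight q j ^ 2 * (S.β j n - S.α j n ^ 2) =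
      ∑ j ∈ S.Ad, S.κ j q ^ 2 * (S.β j n - S.α j n ^ 2) := by
  simp [weight, ite_pow, ite_mul, Finset.sum_ite_mem]

lemma sum_weight_mul_meanGain (n q : Fin K) :
    ∑ j, S.weight q j * S.meanGain n q j =
      if S.l n = S.l q then √((N : ℝ) - τ) * ∑ j ∈ S.Ad, S.κ j q * S.α j n else 0 := by
  simp only [weight, meanGain, ite_mul, zero_mul, Finset.sum_ite_mem, Finset.univ_inter]
  split_ifs
  · rw [Finset.mul_sum]
    exact Finset.sum_congr rfl fun j _ => by ring
  · simp

lemma IsFading.integral_norm_sq_weightedGain (hS : S.IsFading μ h W g) (hN : τ + 1 ≤ N)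
    (n q : Fin K) :
    ∫ ω, ‖S.weightedGain μ h W n q ω‖ ^ 2 ∂μ =
      (if S.l n = S.l q then ((N : ℝ) - τ) * (∑ j ∈ S.Ad, S.κ j q * S.α j n) ^ 2 else 0) +
        ∑ j ∈ S.Ad, S.κ j q ^ 2 * (S.β j n - S.α j n ^ 2) := by
  have hN' : (τ : ℝ) + 1 ≤ N := by exact_mod_cast hN
  have h1 : (fun ω => ‖S.weightedGain μ h W n q ω‖ ^ 2) =ᵐ[μ] fun ω =>
      ‖((∑ j, S.weight q j * S.meanGain n q j : ℝ) : ℂ) +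
        S.errGain μ h W n q (S.weight q) ω‖ ^ 2 := by
    filter_upwards [hS.weightedGain_ae_eq hN n q] with ω hω
    rw [hω]
  rw [integral_congr_ae h1, integral_norm_sq_const_add (hS.memLp_errGain hN n q _)
    (hS.integral_errGain hN n q _), hS.integral_norm_sq_errGain hN, sum_weight_sq,
    sum_weight_mul_meanGain, Complex.norm_real, Real.norm_eq_abs, sq_abs]
  congr 1
  split_ifs
  · rw [mul_pow, Real.sq_sqrt (by linarith)]
  · simp

lemma IsFading.complexVar_weightedGain (hS : S.IsFading μ h W g) (hN : τ + 1 ≤ N) (n q : Fin K) :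
    complexVar (S.weightedGain μ h W n q) μ =
      ∑ j ∈ S.Ad, S.κ j q ^ 2 * (S.β j n - S.α j n ^ 2) := by
  rw [complexVar, hS.integral_weightedGain hN, ← sum_weight_sq,
    ← hS.integral_norm_sq_errGain hN n q]
  refine integral_congr_ae ?_
  filter_upwards [hS.weightedGain_ae_eq hN n q] with ω hω
  rw [hω, add_sub_cancel_left]

end

lemma IsFading.memLp_interUE (hS : S.IsFading μ h W g) {n k : Fin K} (hn : n ∈ S.Ud)
    (hk : k ∈ S.Uu) : MemLp (g n k) 2 μ :=
  memLp_two_of_hasLaw_complexNormal (hS.law_g n hn k hk)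

lemma IsFading.integral_norm_sq_interUE (hS : S.IsFading μ h W g) {n k : Fin K} (hn : n ∈ S.Ud)
    (hk : k ∈ S.Uu) : ∫ ω, ‖g n k ω‖ ^ 2 ∂μ = S.ε n k :=
  integral_norm_sq_of_hasLaw_complexNormal (S.ε_nonneg n k) (hS.law_g n hn k hk)

end CellFree

/-! ### Assembling the SINR. -/

theorem mainTheorem2 {M K N τ : ℕ} (hN : τ + 1 ≤ N) (S : CellFree M K N τ)
    {Ω : Type*} [MeasurableSpace Ω] (μ : Measure Ω) [IsProbabilityMeasure μ]
    (h : Fin M → Fin K → Fin N → Ω → ℂ) (W : Fin M → Fin N → Fin τ → Ω → ℂ)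
    (g : Fin K → Fin K → Ω → ℂ) (hS : S.IsFading μ h W g) (n : Fin K) (hn : n ∈ S.Ud) :
    (∀ j ∈ S.Ad, ∀ q ∈ S.Ud, Integrable (S.zfNormSq h W j q) μ) ∧
    (∀ j ∈ S.Ad, ∀ q ∈ S.Ud, 0 < ∫ ω, S.zfNormSq h W j q ω ∂μ) ∧
    (∀ j ∈ S.Ad, ∀ q ∈ S.Ud, MemLp (S.gain μ h W n q j) 2 μ) ∧
    (∀ k ∈ S.Uu, MemLp (g n k) 2 μ) ∧
    S.dlSINR μ h W g n =
      ((N : ℝ) - τ) * S.Ed * (∑ j ∈ S.Ad, S.α j n * S.κ j n) ^ 2 /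
        (S.EST n + S.MUI n + S.IUE n + S.N0) := by
  refine ⟨fun j _ q _ => hS.integrable_zfNormSq hN j q,
    fun j _ q _ => hS.integral_zfNormSq_pos hN j q, fun j _ q _ => hS.memLp_gain hN n q j,
    fun k hk => hS.memLp_interUE hn hk, ?_⟩
  have hN' : (τ : ℝ) + 1 ≤ N := by exact_mod_cast hN
  rw [CellFree.dlSINR, hS.integral_weightedGain hN, hS.complexVar_weightedGain hN,
    CellFree.sum_weight_mul_meanGain, if_pos rfl, Complex.norm_real, Real.norm_eq_abs, sq_abs,
    mul_pow, Real.sq_sqrt (by linarith)]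
  simp_rw [hS.integral_norm_sq_weightedGain hN]
  have hU : ∑ k ∈ S.Uu, S.Eu k * ∫ ω, ‖g n k ω‖ ^ 2 ∂μ = S.IUE n :=
    Finset.sum_congr rfl fun k hk => by rw [hS.integral_norm_sq_interUE hn hk]
  -- The variance of the desired gain is the `q = n` summand of EST; the other summands are the
  -- error parts of the interference powers.
  have hE : S.EST n = S.Ed * ∑ j ∈ S.Ad, S.κ j n ^ 2 * (S.β j n - S.α j n ^ 2) +
      S.Ed * ∑ q ∈ S.Ud.erase n, ∑ j ∈ S.Ad, S.κ j q ^ 2 * (S.β j n - S.α j n ^ 2) := by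
    rw [← mul_add, Finset.add_sum_erase _ (fun q => ∑ j ∈ S.Ad, S.κ j q ^ 2 *
      (S.β j n - S.α j n ^ 2)) hn, CellFree.EST]
    simp only [Finset.mul_sum, mul_assoc]
  -- The constant parts of the interfering gains survive only for UEs on the pilot of `n`.
  have hM : S.MUI n = S.Ed * ∑ q ∈ S.Ud.erase n, (if S.l n = S.l q then
      ((N : ℝ) - τ) * (∑ j ∈ S.Ad, S.κ j q * S.α j n) ^ 2 else 0) := by
    have hs : (S.Ud ∩ S.pilotSet n).erase n = (S.Ud.erase n).filter fun q => S.l n = S.l q := by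
      ext q
      simp only [CellFree.pilotSet, Finset.mem_erase, Finset.mem_inter, Finset.mem_filter,
        Finset.mem_univ, true_and, and_assoc, eq_comm]
    rw [CellFree.MUI, hs, ← Finset.sum_filter, ← Finset.mul_sum]
    ring
  rw [hU, Finset.sum_add_distrib, hE, hM]
  congr 1
  · simp_rw [mul_comm (S.κ _ _)]
    ring
  · ring
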